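/- **Definitions.** A signature is $\varepsilon\in\{+,-\}^n$, $n\ge 0$. An $\varepsilon$-Cambrian tree is a directed tree with inner vertices labeled bijectively by $[n]$ (arcs go from child to parent; vacant parent or child slots are called outgoing or incoming leaves; for $n=0$ there is a single tree, without vertices) in which, for every vertex $v$: if $\varepsilon_v=-$ then $v$ has one parent and two children, if $\varepsilon_v=+$ then $v$ has one child and two parents (parents and children may be leaves), and the two subtrees on the doubled side, called the left and the right subtree of $v$, carry only labels $<v$, respectively only labels $>v$. The increasing rotation of an arc $i\to j$ with $i<j$ in such a tree reverses this arc, keeps the left subtree $L$ of $i$ at $i$ and the right subtree $R$ of $j$ at $j$, attaches the remaining incoming subtree of $i$ to $j$, and attaches the remaining outgoing subtree of $j$ to $i$. The $\varepsilon$-Cambrian lattice is the set of $\varepsilon$-Cambrian trees ordered by the reflexive and transitive closure of increasing rotations. A signed permutation of size $n$ is a permutation $\tau\in\mathfrak S_n$, read as the word $\tau(1)\cdots\tau(n)$, with a sign attached to each value. For a commutative ring $R$, let $\mathrm{FQSym}_\pm$ be the free $R$-module with basis $(F_\tau)$ indexed by the signed permutations of all sizes, with the bilinear product $F_\tau\cdot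 F_{\tau'}=\sum_{\sigma} F_\sigma$, where $\sigma$ runs over the shifted shuffles of $\tau$ and $\tau'$: the words obtained by shuffling $\tau$ with the word $\tau'$ whose values are shifted by the size of $\tau$, where signs travel with their values. For an $\varepsilon$-Cambrian tree $T$ put $P_T=\sum_\tau F_\tau$, where $\tau$ runs over the linear extensions of $T$ (the permutations of $[n]$, with sign $\varepsilon_v$ on the value $v$, in whose word each child stands before its parents). For an $\varepsilon$-Cambrian tree $T$ on $[n]$ and an $\varepsilon'$-Cambrian tree $T'$ on $[n']$, shift all labels of $T'$ by $n$. The tree $T\nearrow\bar T'$ is obtained by grafting the rightmost outgoing leaf of $T$ on the leftmost incoming leaf of the shifted $T'$, and $T\nwarrow\bar T'$ by grafting the rightmost incoming leaf of $T$ on the leftmost outgoing leaf of the shifted $T'$. (If $n=0$ or $n'=0$, both are the other tree.) **Proposition.** For all Cambrian trees $T$ and $T'$, with signatures $\varepsilon$ and $\varepsilon'$, the trees $T\nearrow\bar T'$ and $T\nwarrow\bar T'$ are $\varepsilon\varepsilon'$-Cambrian trees, where $\varepsilon\varepsilon'$ is the concatenation of the signatures, and $$P_T\cdot P_{T'}=\sum_{S}P_S,$$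 where $S$ runs over the interval $[\,T\nearrow\bar T',\;T\nwarrow\bar T'\,]$ of the $\varepsilon\varepsilon'$-Cambrian lattice. -/

import Mathlib

/-! ### Cambrian trees

A signature is a map `ε : Fin n → ℤˣ`; the sign `-` is `-1` and the sign `+` is `1`.
Vertices are identified with their labels, and the labels `1, …, n` with `Fin n`. Only the inner
vertices of a tree are recorded: its leaves (also called free strands) are the vacant parent and
child slots. An arc `D.Adj a b` goes from the child `a` up to its parent `b`. -/

namespace Cambrian

/-- A directed tree: an orientation of a tree. (The tree without inner vertices is allowed.) -/
def IsDirectedTree {V : Type*} (D : Digraph V) : Prop :=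
  (∀ a b, D.Adj a b → ¬ D.Adj b a) ∧
    D.toSimpleGraphInclusive.Preconnected ∧ D.toSimpleGraphInclusive.IsAcyclic

/-- The subtree at `v` containing the neighbour `a`: the connected component of `a` after
deletion of `v`. -/
def branch {V : Type*} (D : Digraph V) (v a : V) : Set V :=
  {u | ∃ p : D.toSimpleGraphInclusive.Walk a u, v ∉ p.support}

def children {V : Type*} (D : Digraph V) (v : V) : Set V := {a | D.Adj a v}

def parents {V : Type*} (D : Digraph V) (v : V) : Set V := {b | D.Adj v b}

/-- The neighbours of `v` on its doubled side: children of a negative vertex, parents of a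
positive vertex. -/
def doubled {n : ℕ} (ε : Fin n → ℤˣ) (D : Digraph (Fin n)) (v : Fin n) : Set (Fin n) :=
  if ε v = -1 then children D v else parents D v

/-- The neighbours of `v` on its other side: parents of a negative vertex, children of a
positive vertex. -/
def single {n : ℕ} (ε : Fin n → ℤˣ) (D : Digraph (Fin n)) (v : Fin n) : Set (Fin n) :=
  if ε v = -1 then parents D v else children D v

/-- The root of the left subtree of `v`, if that subtree is not just a leaf. -/
def leftRoot {n : ℕ} (ε : Fin n → ℤˣ) (D : Digraph (Fin n)) (v : Fin n) : Set (Fin n) :=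
  {a | a ∈ doubled ε D v ∧ a < v}

/-- The root of the right subtree of `v`, if that subtree is not just a leaf. -/
def rightRoot {n : ℕ} (ε : Fin n → ℤˣ) (D : Digraph (Fin n)) (v : Fin n) : Set (Fin n) :=
  {a | a ∈ doubled ε D v ∧ v < a}

def leftSubtree {n : ℕ} (ε : Fin n → ℤˣ) (D : Digraph (Fin n)) (v : Fin n) : Set (Fin n) :=
  {u | ∃ a ∈ leftRoot ε D v, u ∈ branch D v a}

def rightSubtree {n : ℕ} (ε : Fin n → ℤˣ) (D : Digraph (Fin n)) (v : Fin n) : Set (Fin n) :=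
  {u | ∃ a ∈ rightRoot ε D v, u ∈ branch D v a}

/-- `D` is a Cambrian tree with signature `ε`: a directed tree in which every negative vertex has
one parent and two children, every positive vertex has one child and two parents (each of these
may be a leaf), and all labels in the left (right) subtree of `v` are smaller (larger) than `v`. -/
def IsCambrian {n : ℕ} (ε : Fin n → ℤˣ) (D : Digraph (Fin n)) : Prop :=
  IsDirectedTree D ∧ ∀ v,
    (single ε D v).Subsingleton ∧ (leftRoot ε D v).Subsingleton ∧ (rightRoot ε D v).Subsingleton ∧
      (∀ u ∈ leftSubtree ε D v, u < v) ∧ (∀ u ∈ rightSubtree ε D v, v < u)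

/-- The set of Cambrian trees with signature `ε`. -/
def CambrianTree {n : ℕ} (ε : Fin n → ℤˣ) : Type := {D : Digraph (Fin n) // IsCambrian ε D}

noncomputable instance {n : ℕ} (ε : Fin n → ℤˣ) : Fintype (CambrianTree ε) :=
  haveI : Finite (CambrianTree ε) := inferInstanceAs (Finite {D // IsCambrian ε D})
  Fintype.ofFinite _

/-! ### Rotations and the Cambrian order -/

/-- The result of rotating the arc `i → j` (`i < j`): the arc is reversed, the incoming subtree of
`i` other than its left subtree is attached to `j`, and the outgoing subtree of `j` other than its
right subtree is attached to `i`; all other arcs are kept. -/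
def rotate {n : ℕ} (ε : Fin n → ℤˣ) (D : Digraph (Fin n)) (i j : Fin n) : Digraph (Fin n) where
  Adj x y :=
    (x = j ∧ y = i) ∨
    (y = j ∧ D.Adj x i ∧ x ∉ leftRoot ε D i) ∨
    (x = i ∧ D.Adj j y ∧ y ∉ rightRoot ε D j) ∨
    (D.Adj x y ∧ ¬ (x = i ∧ y = j) ∧ ¬ (y = i ∧ x ∉ leftRoot ε D i) ∧
      ¬ (x = j ∧ y ∉ rightRoot ε D j))

/-- `T → T'` is an increasing rotation. -/
def IsIncreasingRotation {n : ℕ} {ε : Fin n → ℤˣ} (T T' : CambrianTree ε) : Prop :=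
  ∃ i j : Fin n, i < j ∧ T.1.Adj i j ∧ T'.1 = rotate ε T.1 i j

/-- The order of the `ε`-Cambrian lattice: the (reflexive) transitive closure of the increasing
rotation graph. -/
instance {n : ℕ} (ε : Fin n → ℤˣ) : Preorder (CambrianTree ε) where
  le := Relation.ReflTransGen IsIncreasingRotation
  le_refl _ := Relation.ReflTransGen.refl
  le_trans _ _ _ := Relation.ReflTransGen.trans

/-! ### Grafting -/

/-- `v` carries the rightmost outgoing leaf: a parent slot of `v` is vacant (the right one if `v`
is positive), and this leaf lies in no left subtree. -/
def IsRightmostOutgoing {n : ℕ} (ε : Fin n → ℤˣ) (D : Digraph (Fin n)) (v : Fin n) : Prop :=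
  (∀ b, D.Adj v b → ε v = 1 ∧ b < v) ∧ ∀ w, v ∉ leftSubtree ε D w

/-- `v` carries the leftmost outgoing leaf. -/
def IsLeftmostOutgoing {n : ℕ} (ε : Fin n → ℤˣ) (D : Digraph (Fin n)) (v : Fin n) : Prop :=
  (∀ b, D.Adj v b → ε v = 1 ∧ v < b) ∧ ∀ w, v ∉ rightSubtree ε D w

/-- `v` carries the rightmost incoming leaf. -/
def IsRightmostIncoming {n : ℕ} (ε : Fin n → ℤˣ) (D : Digraph (Fin n)) (v : Fin n) : Prop :=
  (∀ a, D.Adj a v → ε v = -1 ∧ a < v) ∧ ∀ w, v ∉ leftSubtree ε D w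

/-- `v` carries the leftmost incoming leaf. -/
def IsLeftmostIncoming {n : ℕ} (ε : Fin n → ℤˣ) (D : Digraph (Fin n)) (v : Fin n) : Prop :=
  (∀ a, D.Adj a v → ε v = -1 ∧ v < a) ∧ ∀ w, v ∉ rightSubtree ε D w

/-- The disjoint union of `D` and of `D'` with labels shifted by `n`, together with the arcs
`a → n + b` for `up a b` and `n + b → a` for `down b a`. -/
def shiftedUnion {n n' : ℕ} (D : Digraph (Fin n)) (D' : Digraph (Fin n'))
    (up : Fin n → Fin n' → Prop) (down : Fin n' → Fin n → Prop) : Digraph (Fin (n + n')) where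
  Adj x y :=
    (∃ a b, x = Fin.castAdd n' a ∧ y = Fin.castAdd n' b ∧ D.Adj a b) ∨
    (∃ a b, x = Fin.natAdd n a ∧ y = Fin.natAdd n b ∧ D'.Adj a b) ∨
    (∃ a b, x = Fin.castAdd n' a ∧ y = Fin.natAdd n b ∧ up a b) ∨
    (∃ b a, x = Fin.natAdd n b ∧ y = Fin.castAdd n' a ∧ down b a)

/-- `T ↗ T̄'`: the rightmost outgoing leaf of `T` is grafted on the leftmost incoming leaf of the
shifted tree `T'`. (If one of the trees has no vertex, the result is the other tree.) -/
def graftUp {n n' : ℕ} {ε : Fin n → ℤˣ} {ε' : Fin n' → ℤˣ} (T : CambrianTree ε)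
    (T' : CambrianTree ε') : Digraph (Fin (n + n')) :=
  shiftedUnion T.1 T'.1
    (fun a b => IsRightmostOutgoing ε T.1 a ∧ IsLeftmostIncoming ε' T'.1 b) (fun _ _ => False)

/-- `T ↖ T̄'`: the rightmost incoming leaf of `T` is grafted on the leftmost outgoing leaf of the
shifted tree `T'`. -/
def graftDown {n n' : ℕ} {ε : Fin n → ℤˣ} {ε' : Fin n' → ℤˣ} (T : CambrianTree ε)
    (T' : CambrianTree ε') : Digraph (Fin (n + n')) :=
  shiftedUnion T.1 T'.1
    (fun _ _ => False) (fun b a => IsLeftmostOutgoing ε' T'.1 b ∧ IsRightmostIncoming ε T.1 a)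

/-! ### Signed permutations and their algebra -/

/-- A signed permutation: position `i` holds the value `perm i`, and the value `v` has the sign
`vsign v`. -/
structure SignedPerm where
  size : ℕ
  perm : Equiv.Perm (Fin size)
  vsign : Fin size → ℤˣ

/-- The permutation `[τ(1), …, τ(n), τ'(1) + n, …, τ'(n') + n]`. -/
def shiftedConcat {n n' : ℕ} (τ : Equiv.Perm (Fin n)) (τ' : Equiv.Perm (Fin n')) :
    Equiv.Perm (Fin (n + n')) :=
  finSumFinEquiv.permCongr (Equiv.Perm.sumCongr τ τ')

/-- The permutations of `n + n'` increasing on the first `n` and on the last `n'` positions. -/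
def IsShuffler (n n' : ℕ) (π : Equiv.Perm (Fin (n + n'))) : Prop :=
  StrictMono (fun i : Fin n => π (Fin.castAdd n' i)) ∧
    StrictMono (fun i : Fin n' => π (Fin.natAdd n i))

open Classical in
/-- The signed shifted shuffle product, where signs travel with values. -/
noncomputable def shiftedShuffle (τ τ' : SignedPerm) : Finset SignedPerm :=
  {π : Equiv.Perm (Fin (τ.size + τ'.size)) | IsShuffler τ.size τ'.size π}.toFinset.image fun π =>
    ⟨τ.size + τ'.size, shiftedConcat τ.perm τ'.perm * π⁻¹, Fin.append τ.vsign τ'.vsign⟩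

/-- The free `R`-module on signed permutations. -/
def FQSym (R : Type*) [CommRing R] : Type _ := SignedPerm →₀ R

noncomputable instance (R : Type*) [CommRing R] : AddCommGroup (FQSym R) :=
  inferInstanceAs (AddCommGroup (SignedPerm →₀ R))

noncomputable instance (R : Type*) [CommRing R] : Module R (FQSym R) :=
  inferInstanceAs (Module R (SignedPerm →₀ R))

/-- The basis element `F_τ`. -/
noncomputable def F (R : Type*) [CommRing R] (τ : SignedPerm) : FQSym R := Finsupp.single τ 1

/-- The product of `FQSym R`: the bilinear extension of `F_τ · F_τ' = ∑_{σ ∈ τ ⧢ τ'} F_σ`. -/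
noncomputable instance (R : Type*) [CommRing R] : Mul (FQSym R) where
  mul f g := Finsupp.sum f fun τ a => Finsupp.sum g fun τ' b =>
    (a * b) • ∑ σ ∈ shiftedShuffle τ τ', F R σ

/-- `τ` is a linear extension of `D`: children appear before their parents in the word of `τ`. -/
def IsLinearExtension {n : ℕ} (D : Digraph (Fin n)) (τ : Equiv.Perm (Fin n)) : Prop :=
  ∀ a b, D.Adj a b → τ.symm a < τ.symm b

open Classical in
/-- The element `P_T = ∑_{τ ∈ L(T)} F_τ`, over the linear extensions of `T`. -/
noncomputable def P (R : Type*) [CommRing R] {n : ℕ} {ε : Fin n → ℤˣ} (T : CambrianTree ε) :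
    FQSym R :=
  ∑ τ : Equiv.Perm (Fin n) with IsLinearExtension T.1 τ, F R ⟨n, τ, ε⟩

end Cambrian

/-!
Linear extensions are studied through strands. Let `σ` be a permutation and draw the vertex `v` at
abscissa `v` and at height the position of `v` in the word of `σ`, with a wall below every negative
and above every positive vertex. A strand from `a` up to `c` crosses no wall: for every label `b`
strictly between `a` and `c`, a negative `b` is below `a` and a positive `b` is above `c`
(`Cambrian.Strand`). If `σ` is a linear extension of a Cambrian tree, then every arc of the tree is
a strand (`Routed.strand_of_arc`), and the ends of every strand are comparable in the tree
(`Routed.transGen_of_strand`), because the path between two incomparable vertices turns at a vertex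
whose wall separates them. As arcs are the covers of the tree order, a permutation is a linear
extension of at most one tree of a given signature (`Routed.eq_of_common_extension`).

Exchanging two adjacent values `i < j` of `σ` keeps the tree, or rotates it at the arc `i → j`
(`CambrianTree.exists_of_swap`). Hence going up in the weak order means going up in the Cambrian
order (`CambrianTree.exists_of_weak_le`); in particular every permutation has a tree
(`exists_tree`), since the identity has one. Conversely an increasing rotation removes relations
`a ≺ b` with `a < b` and adds relations `b ≺ a` only (`CambrianTree.transGen_of_le`).

The product `P_T · P_T'` is the sum over the permutations `σ` whose restrictions to the small and to
the large values are linear extensions of `T` and `T'` (`P_mul_P`). In the weak order such a `σ`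
lies between the two concatenations of its restrictions, which are linear extensions of the two
grafted trees, so its tree lies in the interval (`exists_mem_Icc`). If conversely `S` lies in the interval,
then the order of `S`, restricted to the labels of `T`, is contained in that of `T`. A strand for
the restriction of a linear extension `σ` of `S` is a strand for `σ`, so the tree of the restriction
has all its relations in `S`, hence in `T`, and it must be `T` (`CambrianTree.lt_of_restrict`).

Trees are handled through routing functions (`Routed`): for `u ≠ v`, the neighbour of `v` towards
`u`. In this form the trees produced by rotation and grafting are given by explicit formulas, the
axioms become local conditions, and reversing the arcs or the order of the labels are symmetries.
-/

namespace Cambrian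

/-! ### Routed trees -/

/-- The neighbours on the doubled side of `v`, for an arc relation `r` and the set `neg` of
negative vertices: `doubled` for a bare relation. -/
def Dbl {V : Type*} (r : V → V → Prop) (neg : V → Prop) (v a : V) : Prop :=
  (neg v ∧ r a v) ∨ (¬ neg v ∧ r v a)

/-- The neighbours on the undoubled side of `v`: `single` for a bare relation. -/
def Sgl {V : Type*} (r : V → V → Prop) (neg : V → Prop) (v a : V) : Prop :=
  (neg v ∧ r v a) ∨ (¬ neg v ∧ r a v)

/-- A Cambrian tree presented by its routing function: for `u ≠ v`, `N v u` is the neighbour of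
`v` that begins the path from `v` to `u` (the values `N v v` are irrelevant). So `N v u = a` says
that `u` lies in the branch of `v` at `a`; the axiom `compl` says that the two branches of an arc
are complementary, and `side` that left and right subtrees carry the right labels. -/
structure Routed {V : Type*} [LinearOrder V] (r : V → V → Prop) (neg : V → Prop)
    (N : V → V → V) : Prop where
  asymm : ∀ a b, r a b → ¬ r b a
  adj : ∀ v u, u ≠ v → r v (N v u) ∨ r (N v u) v
  self : ∀ v a, r v a ∨ r a v → N v a = a
  compl : ∀ a b u, r a b → u ≠ a → u ≠ b → (N a u = b ↔ N b u ≠ a)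
  single : ∀ v a b, Sgl r neg v a → Sgl r neg v b → a = b
  left : ∀ v a b, Dbl r neg v a → Dbl r neg v b → a < v → b < v → a = b
  right : ∀ v a b, Dbl r neg v a → Dbl r neg v b → v < a → v < b → a = b
  side : ∀ v u, u ≠ v → Dbl r neg v (N v u) → (N v u < v ↔ u < v)

/-- `b` lies strictly between `a` and `c`, in either order. -/
def Between {V : Type*} [LinearOrder V] (a b c : V) : Prop := (a < b ∧ b < c) ∨ (c < b ∧ b < a)

/-- For heights `s` of the vertices: a vertical strand can lead from `a` up to `c` without crossing
the walls below the negative and above the positive vertices with labels in between. -/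
def Strand {V β : Type*} [LinearOrder V] [Preorder β] (neg : V → Prop) (s : V → β) (a c : V) :
    Prop :=
  s a < s c ∧ ∀ b, Between a b c → (neg b → s b < s a) ∧ (¬ neg b → s c < s b)

theorem lt_of_transGen {V β : Type*} [Preorder β] {r : V → V → Prop} {s : V → β}
    (hs : ∀ a b, r a b → s a < s b) {a b : V} (hab : Relation.TransGen r a b) : s a < s b := by
  induction hab with
  | single h1 => exact hs _ _ h1
  | tail _ h1 ih => exact ih.trans (hs _ _ h1)

namespace Routed

variable {V : Type*} [LinearOrder V] {r : V → V → Prop} {neg : V → Prop} {N : V → V → V}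

/-- Reversing all arcs and all signs. -/
theorem flip (h : Routed r neg N) : Routed (fun a b => r b a) (fun v => ¬ neg v) N where
  asymm a b := h.asymm b a
  adj v u hu := (h.adj v u hu).symm
  self v a ha := h.self v a ha.symm
  compl a b u hab ha hb := by have := h.compl b a u hab hb ha; tauto
  single v a b ha hb := h.single v a b (by unfold Sgl at *; tauto) (by unfold Sgl at *; tauto)
  left v a b ha hb := h.left v a b (by unfold Dbl at *; tauto) (by unfold Dbl at *; tauto)
  right v a b ha hb := h.right v a b (by unfold Dbl at *; tauto) (by unfold Dbl at *; tauto)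
  side v u hu hd := h.side v u hu (by unfold Dbl at *; tauto)

theorem ne_of_adj (h : Routed r neg N) {a b : V} (hab : r a b) : a ≠ b := by
  rintro rfl; exact h.asymm _ _ hab hab

/-- Reversing the order of the labels exchanges left and right. -/
theorem dual (h : Routed r neg N) : Routed (V := Vᵒᵈ) r neg N where
  asymm := h.asymm
  adj := h.adj
  self := h.self
  compl := h.compl
  single := h.single
  left v a b ha hb := h.right v a b ha hb
  right v a b ha hb := h.left v a b ha hb
  side v u hu hd := by
    have hne : N v u ≠ v := by
      rcases h.adj v u hu with h1 | h1
      · exact (h.ne_of_adj h1).symm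
      · exact h.ne_of_adj h1
    have h2 := h.side v u hu hd
    change @LT.lt V _ v (N v u) ↔ @LT.lt V _ v u
    constructor <;> intro h3
    · exact lt_of_le_of_ne (not_lt.1 fun h4 => lt_asymm h3 (h2.2 h4)) hu.symm
    · exact lt_of_le_of_ne (not_lt.1 fun h4 => lt_asymm h3 (h2.1 h4)) hne.symm

theorem side' (h : Routed r neg N) {v u : V} (hu : u ≠ v) (hd : Dbl r neg v (N v u)) :
    v < N v u ↔ v < u :=
  h.dual.side v u hu hd

theorem route_ne (h : Routed r neg N) {v u : V} (hu : u ≠ v) : N v u ≠ v := by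
  rcases h.adj v u hu with h1 | h1
  · exact (h.ne_of_adj h1).symm
  · exact h.ne_of_adj h1

theorem compl' (h : Routed r neg N) {a b u : V} (hab : r a b ∨ r b a) (ha : u ≠ a) (hb : u ≠ b) :
    N a u = b ↔ N b u ≠ a := by
  rcases hab with hab | hab
  · exact h.compl a b u hab ha hb
  · exact h.flip.compl a b u hab ha hb

/-- Induction along the routes towards `u`. -/
theorem induct_toward [Finite V] (h : Routed r neg N) (u : V) {p : V → Prop} (base : p u)
    (step : ∀ v, v ≠ u → p (N v u) → p v) (v : V) : p v := by
  suffices H : ∀ (S : Set V) (v : V), S = {w | w ≠ v ∧ N v w = N v u} → p v from H _ v rfl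
  intro S
  induction S using WellFoundedLT.induction with
  | ind S ih =>
    intro v hS
    by_cases hv : v = u
    · exact hv ▸ base
    have hadj := h.adj v u (Ne.symm hv)
    have hne := h.route_ne (Ne.symm hv)
    refine step v hv ?_
    by_cases hau : N v u = u
    · rw [hau]; exact base
    have hN : N (N v u) u ≠ v := (h.compl' hadj (Ne.symm hv) (Ne.symm hau)).1 rfl
    refine ih _ ?_ _ rfl
    rw [hS]
    refine ⟨fun w hw => ?_, fun hsub => ?_⟩
    · obtain ⟨hw1, hw2⟩ := hw
      have hwv : w ≠ v := by
        rintro rfl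
        exact hN (hw2.symm.trans (h.self _ _ hadj.symm))
      exact ⟨hwv, (h.compl' hadj hwv hw1).2 (hw2 ▸ hN)⟩
    · have := @hsub (N v u) ⟨hne, h.self _ _ hadj⟩
      exact this.1 rfl

/-- Neighbours different from `v` lie in the same branch of `v`. -/
theorem route_congr [Finite V] (h : Routed r neg N) {x y : V} (hxy : r x y ∨ r y x) (v : V)
    (hx : x ≠ v) (hy : y ≠ v) : N v x = N v y := by
  revert hx hy
  refine h.induct_toward x (p := fun v => x ≠ v → y ≠ v → N v x = N v y)
    (fun hx => (hx rfl).elim) (fun v hv ih hx hy => ?_) v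
  have hadj := h.adj v x hx
  by_cases hax : x = N v x
  · rw [← hax]
    rw [← hax] at hadj
    refine ((h.compl' hadj hy ?_).2 ?_).symm
    · rintro rfl
      rcases hxy with h1 | h1 <;> exact h.asymm _ _ h1 h1
    · rw [h.self _ _ hxy]; exact hy
  by_cases hay : y = N v x
  · rw [← hay]; rw [← hay] at hadj; exact (h.self _ _ hadj).symm
  have := ih hax hay
  have hN := (h.compl' hadj hx hax).1 rfl
  exact ((h.compl' hadj hy hay).2 (this ▸ hN)).symm

/-- A directed path from `v` stays in the branch of `v` where it starts. -/
theorem route_of_path [Finite V] (h : Routed r neg N) {v x u : V} (hvx : r v x)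
    (hxu : Relation.ReflTransGen r x u) : u ≠ v ∧ N v u = x := by
  induction hxu with
  | refl => exact ⟨(h.ne_of_adj hvx).symm, h.self _ _ (Or.inl hvx)⟩
  | @tail u w _ huw ih =>
    have hw : w ≠ v := by
      rintro rfl
      have h1 := h.self _ _ (Or.inr huw)
      rw [ih.2] at h1
      exact h.asymm _ _ hvx (h1 ▸ huw)
    exact ⟨hw, (h.route_congr (Or.inl huw) v ih.1 hw).symm.trans ih.2⟩

theorem adj_route_of_transGen [Finite V] (h : Routed r neg N) {v u : V}
    (hvu : Relation.TransGen r v u) : u ≠ v ∧ r v (N v u) := by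
  obtain ⟨x, hx, hxu⟩ := Relation.TransGen.head'_iff.1 hvu
  obtain ⟨h1, h2⟩ := h.route_of_path hx hxu
  exact ⟨h1, h2 ▸ hx⟩

theorem adj_route_of_transGen' [Finite V] (h : Routed r neg N) {v u : V}
    (hvu : Relation.TransGen r u v) : u ≠ v ∧ r (N v u) v :=
  h.flip.adj_route_of_transGen (Relation.transGen_swap.2 hvu)

/-- If the path from `a` to `c` starts upwards, then it either is directed or turns for the first
time at a vertex `b` above `a`. -/
theorem up_or_turn [Finite V] (h : Routed r neg N) {a c : V} (hac : a ≠ c) (hr : r a (N a c)) :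
    Relation.TransGen r a c ∨ ∃ b, Relation.TransGen r a b ∧ c ≠ b ∧ r (N b a) b ∧
      r (N b c) b ∧ N b a ≠ N b c := by
  revert hac hr
  refine h.induct_toward c (p := fun a => a ≠ c → r a (N a c) → (Relation.TransGen r a c ∨
    ∃ b, Relation.TransGen r a b ∧ c ≠ b ∧ r (N b a) b ∧ r (N b c) b ∧ N b a ≠ N b c))
    (fun hx => (hx rfl).elim) (fun a _ ih hac hr => ?_) a
  by_cases hxc : N a c = c
  · left; rw [hxc] at hr; exact .single hr
  have hN := (h.compl _ _ c hr (Ne.symm hac) (Ne.symm hxc)).1 rfl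
  have hself := h.self (N a c) a (Or.inr hr)
  rcases h.adj (N a c) c (Ne.symm hxc) with h1 | h1
  · rcases ih hxc h1 with h2 | ⟨b, hb, hcb, h2, h3, h4⟩
    · left; exact .head hr h2
    · right
      have hab := Relation.TransGen.head hr hb
      have := h.route_congr (Or.inl hr) b (h.adj_route_of_transGen hab).1.symm
        (h.adj_route_of_transGen hb).1.symm
      exact ⟨b, hab, hcb, this ▸ h2, h3, this ▸ h4⟩
  · right
    exact ⟨N a c, .single hr, Ne.symm hxc, by rwa [hself], h1, by rw [hself]; exact hN.symm⟩

/-- Two vertices in different doubled branches of `b` are separated by `b`. -/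
theorem between_of_dbl (h : Routed r neg N) {a b c : V} (ha : a ≠ b) (hc : c ≠ b)
    (h1 : Dbl r neg b (N b a)) (h2 : Dbl r neg b (N b c)) (hne : N b a ≠ N b c) :
    Between a b c := by
  have h3 := h.side b a ha h1
  have h4 := h.side b c hc h2
  have h5 := h.side' ha h1
  have h6 := h.side' hc h2
  rcases lt_or_gt_of_ne ha with h7 | h7 <;> rcases lt_or_gt_of_ne hc with h8 | h8
  · exact (hne (h.left _ _ _ h1 h2 (h3.2 h7) (h4.2 h8))).elim
  · exact .inl ⟨h7, h8⟩
  · exact .inr ⟨h8, h7⟩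
  · exact (hne (h.right _ _ _ h1 h2 (h5.2 h7) (h6.2 h8))).elim

/-- If the path from `a` to `c` starts upwards, then it either is directed or turns at a negative
vertex `b` above `a` whose label lies between `a` and `c`. -/
theorem up_or_between [Finite V] (h : Routed r neg N) {a c : V} (hac : a ≠ c)
    (hr : r a (N a c)) : Relation.TransGen r a c ∨
      ∃ b, Relation.TransGen r a b ∧ neg b ∧ c ≠ b ∧ r (N b a) b ∧ r (N b c) b ∧
        N b a ≠ N b c ∧ Between a b c := by
  rcases h.up_or_turn hac hr with h1 | ⟨b, hab, hcb, h1, h2, h3⟩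
  · exact .inl h1
  · have hb : neg b := by
      by_contra hb
      exact h3 (h.single b _ _ (.inr ⟨hb, h1⟩) (.inr ⟨hb, h2⟩))
    exact .inr ⟨b, hab, hb, hcb, h1, h2, h3,
      h.between_of_dbl (h.adj_route_of_transGen hab).1.symm hcb (.inl ⟨hb, h1⟩) (.inl ⟨hb, h2⟩) h3⟩

/-- A negative vertex whose label lies between the ends of an edge `a — c`, on the side of `c`,
is a descendant of `c`. -/
theorem transGen_of_between [Finite V] (h : Routed r neg N) {a b c : V} (hac : r a c ∨ r c a)
    (hb : Between a b c) (hneg : neg b) (hside : N a b = c) : Relation.TransGen r b c := by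
  have hba : b ≠ a := by rcases hb with h1 | h1 <;> [exact h1.1.ne'; exact h1.2.ne]
  have hbc : b ≠ c := by rcases hb with h1 | h1 <;> [exact h1.2.ne; exact h1.1.ne']
  rcases h.adj b c hbc.symm with h1 | h1
  · rcases h.up_or_between hbc h1 with h2 | ⟨d, hbd, hd, hcd, hdb, hdc, hne, hbet⟩
    · exact h2
    have hbd' := (h.adj_route_of_transGen hbd).1
    -- otherwise both `a` and `c` lie in the branch of `d` not containing `b`
    have had : a ≠ d := by
      rintro rfl
      exact hne (hside.trans (h.self _ _ hac).symm)
    have hac' := h.route_congr hac d had hcd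
    have hturn : Between a d b :=
      h.between_of_dbl had hbd'.symm (.inl ⟨hd, by rwa [hac']⟩) (.inl ⟨hd, hdb⟩)
        (by rw [hac']; exact hne.symm)
    exfalso
    rcases hb with ⟨h4, h5⟩ | ⟨h4, h5⟩ <;> rcases hbet with ⟨h6, h7⟩ | ⟨h6, h7⟩ <;>
      rcases hturn with ⟨h8, h9⟩ | ⟨h8, h9⟩ <;> order
  · exfalso
    have hd : Dbl r neg b (N b c) := .inl ⟨hneg, h1⟩
    have hac' := h.route_congr hac b hba.symm hbc.symm
    have h2 := h.side b c hbc.symm hd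
    have h3 := h.side b a hba.symm (hac' ▸ hd)
    rw [hac'] at h3
    rcases hb with ⟨h4, h5⟩ | ⟨h4, h5⟩
    · exact lt_asymm h5 (h2.1 (h3.2 h4))
    · exact lt_asymm h5 (h3.1 (h2.2 h4))

/-- A negative vertex whose label lies between the ends of an arc is below this arc: on the side
of the upper end `c`, it would be a second lower neighbour of `c` on the wrong side. -/
theorem transGen_of_arc_of_neg [Finite V] (h : Routed r neg N) {a b c : V} (hac : r a c)
    (hb : Between a b c) (hneg : neg b) : Relation.TransGen r b a := by
  have hba : b ≠ a := by rcases hb with h1 | h1 <;> [exact h1.1.ne'; exact h1.2.ne]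
  have hbc : b ≠ c := by rcases hb with h1 | h1 <;> [exact h1.2.ne; exact h1.1.ne']
  by_cases hside : N a b = c
  · exfalso
    have h1 := h.adj_route_of_transGen' (h.transGen_of_between (.inl hac) hb hneg hside)
    have h2 := (h.compl _ _ _ hac hba hbc).1 hside
    have h3 : N c a = a := h.self _ _ (.inr hac)
    have hc : neg c := by
      by_contra hc
      exact h2 (h.single c _ _ (.inr ⟨hc, h1.2⟩) (.inr ⟨hc, hac⟩))
    have h6 := h.between_of_dbl (a := a) (b := c) (c := b) (h.ne_of_adj hac) hbc
      (.inl ⟨hc, by rwa [h3]⟩) (.inl ⟨hc, h1.2⟩) (by rw [h3]; exact h2.symm)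
    rcases hb with ⟨h4, h5⟩ | ⟨h4, h5⟩ <;> rcases h6 with ⟨h6, h7⟩ | ⟨h6, h7⟩ <;> order
  · refine h.transGen_of_between (.inr hac) ?_ hneg ?_
    · unfold Between at *; tauto
    · by_contra h5
      exact hside ((h.compl _ _ _ hac hba hbc).2 h5)

theorem transGen_of_arc_of_pos [Finite V] (h : Routed r neg N) {a b c : V} (hac : r a c)
    (hb : Between a b c) (hpos : ¬ neg b) : Relation.TransGen r c b :=
  Relation.transGen_swap.1 (h.flip.transGen_of_arc_of_neg (a := c) (c := a) hac
    (by unfold Between at *; tauto) hpos)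

/-- The arcs of a Cambrian tree are strands for every linear extension. -/
theorem strand_of_arc [Finite V] (h : Routed r neg N) {β : Type*} [Preorder β] {s : V → β}
    (hs : ∀ a b, r a b → s a < s b) {a c : V} (hac : r a c) : Strand neg s a c :=
  ⟨hs _ _ hac, fun _ hb =>
    ⟨fun hn => lt_of_transGen hs (h.transGen_of_arc_of_neg hac hb hn),
      fun hp => lt_of_transGen hs (h.transGen_of_arc_of_pos hac hb hp)⟩⟩

/-- The ends of a strand are comparable in every Cambrian tree that has the heights as a linear
extension. -/
theorem transGen_of_strand [Finite V] (h : Routed r neg N) {β : Type*} [Preorder β] {s : V → β}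
    (hs : ∀ a b, r a b → s a < s b) {a c : V} (hac : Strand neg s a c) :
    Relation.TransGen r a c := by
  have hne : a ≠ c := by rintro rfl; exact lt_irrefl _ hac.1
  rcases h.adj a c hne.symm with h1 | h1
  · rcases h.up_or_between hne h1 with h2 | ⟨b, hab, hb, _, _, _, _, hbet⟩
    · exact h2
    · exact (lt_asymm (lt_of_transGen hs hab) ((hac.2 b hbet).1 hb)).elim
  · exfalso
    rcases h.flip.up_or_between hne h1 with h2 | ⟨b, hab, hb, _, _, _, _, hbet⟩
    · exact lt_asymm hac.1 (lt_of_transGen hs (Relation.transGen_swap.1 h2))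
    · exact lt_asymm ((lt_of_transGen hs (Relation.transGen_swap.1 hab)).trans hac.1)
        ((hac.2 b hbet).2 hb)

/-- An arc is a cover relation of the tree order. -/
theorem not_transGen_of_arc [Finite V] (h : Routed r neg N) {a x c : V} (hac : r a c)
    (h1 : Relation.TransGen r a x) (h2 : Relation.TransGen r x c) : False := by
  have hxa := (h.adj_route_of_transGen h1).1
  have hxc := (h.adj_route_of_transGen' h2).1
  obtain ⟨w, haw, hwx⟩ := Relation.TransGen.head'_iff.1 h1
  have h3 := h.route_of_path haw hwx
  have h4 := h.route_of_path haw (hwx.trans h2.to_reflTransGen)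
  obtain ⟨y, hxy, hyc⟩ := Relation.TransGen.tail'_iff.1 h2
  have h5 := h.flip.route_of_path hyc (Relation.reflTransGen_swap.2 hxy)
  have h6 := h.flip.route_of_path hyc (Relation.reflTransGen_swap.2 (h1.to_reflTransGen.trans hxy))
  have hwc : w = c := h4.2.symm.trans (h.self _ _ (.inl hac))
  have hya : y = a := h6.2.symm.trans (h.self _ _ (.inr hac))
  exact (h.compl _ _ _ hac hxa hxc).1 (h3.2.trans hwc) (h5.2.trans hya)

/-- A routed tree is determined by its order. -/
theorem arc_of_transGen_iff [Finite V] (h : Routed r neg N) {r' : V → V → Prop}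
    (hiff : ∀ a b, Relation.TransGen r a b ↔ Relation.TransGen r' a b) {a c : V} (hac : r a c) :
    r' a c := by
  obtain ⟨x, hax, hxc⟩ := Relation.TransGen.head'_iff.1 ((hiff a c).1 (.single hac))
  rcases Relation.reflTransGen_iff_eq_or_transGen.1 hxc with h1 | h1
  · exact h1 ▸ hax
  · exact (h.not_transGen_of_arc hac ((hiff _ _).2 (.single hax)) ((hiff _ _).2 h1)).elim

/-- Two Cambrian trees of the same signature with a common linear extension are equal. -/
theorem eq_of_common_extension [Finite V] (h : Routed r neg N) {r' : V → V → Prop}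
    {N' : V → V → V} (h' : Routed r' neg N') {β : Type*} [Preorder β] {s : V → β}
    (hs : ∀ a b, r a b → s a < s b) (hs' : ∀ a b, r' a b → s a < s b) : r = r' := by
  have h1 : ∀ a b, Relation.TransGen r a b → Relation.TransGen r' a b := fun a b hab =>
    Relation.TransGen.closed (fun _ _ hxy =>
      h'.transGen_of_strand hs' (h.strand_of_arc hs hxy)) _ _ hab
  have h2 : ∀ a b, Relation.TransGen r' a b → Relation.TransGen r a b := fun a b hab =>
    Relation.TransGen.closed (fun _ _ hxy =>
      h.transGen_of_strand hs (h'.strand_of_arc hs' hxy)) _ _ hab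
  have h3 : ∀ a b, Relation.TransGen r a b ↔ Relation.TransGen r' a b := fun a b =>
    ⟨h1 a b, h2 a b⟩
  funext a b
  exact propext ⟨h.arc_of_transGen_iff h3, h'.arc_of_transGen_iff fun a b => (h3 a b).symm⟩

/-- A Cambrian tree has a linear extension: the number of vertices below a vertex. -/
theorem exists_height [Finite V] (h : Routed r neg N) : ∃ s : V → ℕ, ∀ a b, r a b → s a < s b := by
  refine ⟨fun v => {x | Relation.TransGen r x v}.ncard, fun a b hab => ?_⟩
  refine Set.ncard_lt_ncard ⟨fun x hx => hx.tail hab, fun hsub => ?_⟩ (Set.toFinite _)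
  exact (h.adj_route_of_transGen (hsub (.single hab : Relation.TransGen r a b))).1 rfl

end Routed
end Cambrian

namespace Cambrian

/-! ### Rotations -/

/-- The incoming subtrees of `i` that the rotation of an arc at `i` moves: all but the left one. -/
def MovesIn {V : Type*} [LinearOrder V] (r : V → V → Prop) (neg : V → Prop) (i x : V) : Prop :=
  r x i ∧ ¬ (Dbl r neg i x ∧ x < i)

/-- The outgoing subtrees of `j` that the rotation of an arc at `j` moves: all but the right
one. -/
def MovesOut {V : Type*} [LinearOrder V] (r : V → V → Prop) (neg : V → Prop) (j y : V) : Prop :=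
  r j y ∧ ¬ (Dbl r neg j y ∧ j < y)

/-- `rotate` for a bare relation. -/
def Rot {V : Type*} [LinearOrder V] (r : V → V → Prop) (neg : V → Prop) (i j x y : V) : Prop :=
  (x = j ∧ y = i) ∨ (y = j ∧ MovesIn r neg i x) ∨ (x = i ∧ MovesOut r neg j y) ∨
    (r x y ∧ ¬ (x = i ∧ y = j) ∧ ¬ (y = i ∧ MovesIn r neg i x) ∧ ¬ (x = j ∧ MovesOut r neg j y))

open Classical in
/-- The routing function after a rotation. Only the routes through the arc between `i` and `j` or
between one of its ends and a moved subtree change. -/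
noncomputable def rotRoute {V : Type*} [LinearOrder V] (r : V → V → Prop) (neg : V → Prop)
    (N : V → V → V) (i j v u : V) : V :=
  if v = i then
    if u = j then j
    else if N i u = j then (if MovesOut r neg j (N j u) then N j u else j)
    else if MovesIn r neg i (N i u) then j else N i u
  else if v = j then
    if u = i then i
    else if N j u = i then (if MovesIn r neg i (N i u) then N i u else i)
    else if MovesOut r neg j (N j u) then i else N j u
  else if N v u = i ∧ MovesIn r neg i v then j
  else if N v u = j ∧ MovesOut r neg j v then i else N v u

namespace Routed

variable {V : Type*} [LinearOrder V] {r : V → V → Prop} {neg : V → Prop} {N : V → V → V}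

/-- The tree has no triangle. -/
theorem not_adj_of_arc (h : Routed r neg N) {i j x : V} (hij : r i j) (hi : r i x ∨ r x i)
    (hj : r j x ∨ r x j) : False := by
  have hxi : x ≠ i := by rintro rfl; rcases hi with h1 | h1 <;> exact h.asymm _ _ h1 h1
  have hxj : x ≠ j := by rintro rfl; rcases hj with h1 | h1 <;> exact h.asymm _ _ h1 h1
  have h1 := h.compl i j x hij hxi hxj
  rw [h.self _ _ hi, h.self _ _ hj] at h1
  exact hxj (h1.2 hxi)

theorem rot_asymm (h : Routed r neg N) {i j : V} (hij : r i j) (a b : V)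
    (hab : Rot r neg i j a b) : ¬ Rot r neg i j b a := by
  have h0 := h.asymm
  have h1 := fun x => h.not_adj_of_arc (x := x) hij
  unfold Rot MovesIn MovesOut at *
  generalize Dbl r neg = D at *
  grind

theorem rot_adj (h : Routed r neg N) {i j : V} (hij : r i j) (v u : V) (hu : u ≠ v) :
    Rot r neg i j v (rotRoute r neg N i j v u) ∨ Rot r neg i j (rotRoute r neg N i j v u) v := by
  have h0 := h.asymm
  have h1 := fun x => h.not_adj_of_arc (x := x) hij
  have h2 := h.adj
  unfold Rot rotRoute
  have h3 : ∀ x, MovesIn r neg i x → r x i := fun x h => h.1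
  have h4 : ∀ x, MovesOut r neg j x → r j x := fun x h => h.1
  generalize MovesIn r neg i = mi at *
  generalize MovesOut r neg j = mo at *
  by_cases hvi : v = i
  · subst hvi
    have := h2 v u
    have := h2 j u
    clear h2
    grind
  by_cases hvj : v = j
  · subst hvj
    have := h2 v u
    have := h2 i u
    clear h2
    grind
  have := h2 v u
  clear h2
  grind

/-- The routes between a moved subtree of `i`, given by its root `x`, and the ends of `i → j`. -/
theorem movesIn_route [Finite V] (h : Routed r neg N) {i j x : V} (hij : r i j)
    (hx : MovesIn r neg i x) :
    x ≠ i ∧ x ≠ j ∧ N i x = x ∧ N x i = i ∧ N j x = i ∧ N x j = i := by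
  have h1 := h.ne_of_adj hx.1
  have h2 : x ≠ j := by rintro rfl; exact h.asymm _ _ hij hx.1
  have h3 := h.self _ _ (.inr hij)
  have h4 := h.self _ _ (.inl hx.1)
  exact ⟨h1, h2, h.self _ _ (.inr hx.1), h4,
    (h.route_congr (.inl hx.1) j h2 (h.ne_of_adj hij)).trans h3,
    (h.route_congr (.inr hij) x h2.symm h1.symm).trans h4⟩

/-- The routes between a moved subtree of `j`, given by its root `x`, and the ends of `i → j`. -/
theorem movesOut_route [Finite V] (h : Routed r neg N) {i j x : V} (hij : r i j)
    (hx : MovesOut r neg j x) :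
    x ≠ i ∧ x ≠ j ∧ N j x = x ∧ N x j = j ∧ N i x = j ∧ N x i = j := by
  have h1 := h.ne_of_adj hx.1
  have h2 : x ≠ i := by rintro rfl; exact h.asymm _ _ hij hx.1
  have h3 := h.self _ _ (.inl hij)
  have h4 := h.self _ _ (.inr hx.1)
  exact ⟨h2, h1.symm, h.self _ _ (.inl hx.1), h4,
    (h.route_congr (.inr hx.1) i h2 (h.ne_of_adj hij).symm).trans h3,
    (h.route_congr (.inl hij) x h2.symm h1).trans h4⟩

theorem rot_self [Finite V] (h : Routed r neg N) {i j : V} (hij : r i j) (v a : V)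
    (ha : Rot r neg i j v a ∨ Rot r neg i j a v) : rotRoute r neg N i j v a = a := by
  have h0 := h.asymm
  have hne := h.ne_of_adj hij
  have h2 := h.self v a
  have hi := fun x => h.movesIn_route (x := x) hij
  have ho := fun x => h.movesOut_route (x := x) hij
  unfold Rot rotRoute at *
  have h3 : ∀ x, MovesIn r neg i x → r x i := fun x h => h.1
  have h4 : ∀ x, MovesOut r neg j x → r j x := fun x h => h.1
  generalize MovesIn r neg i = mi at *
  generalize MovesOut r neg j = mo at *
  have h5 := hi v
  have h6 := hi a
  have h7 := ho v
  have h8 := ho a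
  clear hi ho
  rcases ha with (ha | ha | ha | ha) | (ha | ha | ha | ha) <;> grind

theorem movesIn_unique (h : Routed r neg N) {i x y : V} (hx : MovesIn r neg i x)
    (hy : MovesIn r neg i y) : x = y := by
  have h1 := h.ne_of_adj hx.1
  have h2 := h.ne_of_adj hy.1
  by_cases hn : neg i
  · refine h.right i x y (.inl ⟨hn, hx.1⟩) (.inl ⟨hn, hy.1⟩) ?_ ?_
    · exact lt_of_le_of_ne (not_lt.1 fun h3 => hx.2 ⟨.inl ⟨hn, hx.1⟩, h3⟩) h1.symm
    · exact lt_of_le_of_ne (not_lt.1 fun h3 => hy.2 ⟨.inl ⟨hn, hy.1⟩, h3⟩) h2.symm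
  · exact h.single i x y (.inr ⟨hn, hx.1⟩) (.inr ⟨hn, hy.1⟩)

theorem movesOut_unique (h : Routed r neg N) {j x y : V} (hx : MovesOut r neg j x)
    (hy : MovesOut r neg j y) : x = y := by
  have h1 := h.ne_of_adj hx.1
  have h2 := h.ne_of_adj hy.1
  by_cases hn : neg j
  · exact h.single j x y (.inl ⟨hn, hx.1⟩) (.inl ⟨hn, hy.1⟩)
  · refine h.left j x y (.inr ⟨hn, hx.1⟩) (.inr ⟨hn, hy.1⟩) ?_ ?_
    · exact lt_of_le_of_ne (not_lt.1 fun h3 => hx.2 ⟨.inr ⟨hn, hx.1⟩, h3⟩) h1.symm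
    · exact lt_of_le_of_ne (not_lt.1 fun h3 => hy.2 ⟨.inr ⟨hn, hy.1⟩, h3⟩) h2.symm

theorem route_route (h : Routed r neg N) {v u : V} (hu : u ≠ v) : N v (N v u) = N v u :=
  h.self _ _ (h.adj v u hu)

theorem rot_compl [Finite V] (h : Routed r neg N) {i j : V} (hij : r i j) (a b u : V)
    (hab : Rot r neg i j a b) (ha : u ≠ a) (hb : u ≠ b) :
    rotRoute r neg N i j a u = b ↔ rotRoute r neg N i j b u ≠ a := by
  have h0 := h.asymm
  have hne := h.ne_of_adj hij
  have hi := fun x => h.movesIn_route (x := x) hij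
  have ho := fun x => h.movesOut_route (x := x) hij
  have hmi := fun x y => h.movesIn_unique (i := i) (x := x) (y := y)
  have hmo := fun x y => h.movesOut_unique (j := j) (x := x) (y := y)
  have hself := fun v => h.route_route (v := v) (u := u)
  have hNi := h.self i j (.inl hij)
  have hNj := h.self j i (.inr hij)
  have h5 := h.compl
  have hcij := h5 i j u hij
  unfold Rot rotRoute at *
  have h3 : ∀ x, MovesIn r neg i x → r x i := fun x h => h.1
  have h4 : ∀ x, MovesOut r neg j x → r j x := fun x h => h.1
  generalize MovesIn r neg i = mi at *
  generalize MovesOut r neg j = mo at *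
  rcases hab with hab | hab | hab | hab
  · obtain ⟨rfl, rfl⟩ := hab
    clear h5
    grind
  · have h6 := h5 a i u
    have h7 := hi a hab.2
    clear h5
    grind
  · have h6 := h5 j b u
    have h7 := ho b hab.2
    clear h5
    grind
  · have h6 := h5 a b u hab.1 ha hb
    clear h5
    grind (splits := 20)

theorem rot_single (h : Routed r neg N) {i j : V} (hij : r i j) (v a b : V)
    (ha : Sgl (Rot r neg i j) neg v a) (hb : Sgl (Rot r neg i j) neg v b) : a = b := by
  have h0 := h.asymm
  have h1 := fun x => h.not_adj_of_arc (x := x) hij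
  have hmi := fun x y => h.movesIn_unique (i := i) (x := x) (y := y)
  have hmo := fun x y => h.movesOut_unique (j := j) (x := x) (y := y)
  have h2 := h.single v
  clear h
  unfold Sgl Rot at *
  have h3 : ∀ x, MovesIn r neg i x → r x i := fun x h => h.1
  have h4 : ∀ x, MovesOut r neg j x → r j x := fun x h => h.1
  have h5 : ∀ x, r x i → ¬ MovesIn r neg i x → neg i := by
    unfold MovesIn Dbl; grind
  have h6 : ∀ x, r j x → ¬ MovesOut r neg j x → ¬ neg j := by
    unfold MovesOut Dbl; grind
  generalize MovesIn r neg i = mi at *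
  generalize MovesOut r neg j = mo at *
  by_cases hv : neg v <;>
    simp only [hv, true_and, false_and, or_false, false_or, not_true, not_false_eq_true] at ha hb h2
  · rcases ha with ha | ha | ha | ha <;> rcases hb with hb | hb | hb | hb <;> grind
  · rcases ha with ha | ha | ha | ha <;> rcases hb with hb | hb | hb | hb <;> grind

/-- A moved subtree of `i` sees `i` and `j` on the same side, and lies on the side of `j` where
`i` was. -/
theorem movesIn_side [Finite V] (h : Routed r neg N) {i j x : V} (hij : r i j)
    (hx : MovesIn r neg i x) : (¬ neg x → (i < x ↔ j < x)) ∧ (neg j → (i < j ↔ x < j)) := by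
  obtain ⟨h1, h2, h3, h4, h5, h6⟩ := h.movesIn_route hij hx
  refine ⟨fun hn => ?_, fun hn => ?_⟩
  · have := h.side x j h2.symm (.inr ⟨hn, by rw [h6]; exact hx.1⟩)
    rwa [h6] at this
  · have := h.side j x h2 (.inl ⟨hn, by rwa [h5]⟩)
    rwa [h5] at this

/-- A moved subtree of `j` sees `i` and `j` on the same side, and lies on the side of `i` where
`j` was. -/
theorem movesOut_side [Finite V] (h : Routed r neg N) {i j x : V} (hij : r i j)
    (hx : MovesOut r neg j x) : (neg x → (j < x ↔ i < x)) ∧ (¬ neg i → (j < i ↔ x < i)) := by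
  obtain ⟨h1, h2, h3, h4, h5, h6⟩ := h.movesOut_route hij hx
  refine ⟨fun hn => ?_, fun hn => ?_⟩
  · have := h.side x i h1.symm (.inl ⟨hn, by rw [h6]; exact hx.1⟩)
    rwa [h6] at this
  · have := h.side i x h1 (.inr ⟨hn, by rwa [h5]⟩)
    rwa [h5] at this

theorem rot_left [Finite V] (h : Routed r neg N) {i j : V} (hij : r i j) (hlt : i < j)
    (v a b : V) (ha : Dbl (Rot r neg i j) neg v a) (hb : Dbl (Rot r neg i j) neg v b)
    (hav : a < v) (hbv : b < v) : a = b := by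
  have h0 := h.asymm
  have h1 := fun x => h.not_adj_of_arc (x := x) hij
  have hmi := fun x y => h.movesIn_unique (i := i) (x := x) (y := y)
  have hmo := fun x y => h.movesOut_unique (j := j) (x := x) (y := y)
  have hsi := fun x => h.movesIn_side (x := x) hij
  have hso := fun x => h.movesOut_side (x := x) hij
  have h2 := h.left v
  clear h
  unfold Rot at ha hb
  unfold Dbl at *
  have h3 : ∀ x, MovesIn r neg i x → r x i := fun x h => h.1
  have h4 : ∀ x, MovesOut r neg j x → r j x := fun x h => h.1
  have h5 : ∀ x, r x i → (MovesIn r neg i x ↔ (neg i → ¬ x < i)) := by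
    unfold MovesIn Dbl; grind
  have h6 : ∀ x, r j x → (MovesOut r neg j x ↔ (¬ neg j → ¬ j < x)) := by
    unfold MovesOut Dbl; grind
  generalize MovesIn r neg i = mi at *
  generalize MovesOut r neg j = mo at *
  by_cases hv : neg v <;>
    simp only [hv, true_and, false_and, or_false, false_or, not_true, not_false_eq_true] at ha hb h2
  · rcases ha with ha | ha | ha | ha <;> rcases hb with hb | hb | hb | hb <;> grind
  · rcases ha with ha | ha | ha | ha <;> rcases hb with hb | hb | hb | hb <;> grind

theorem rot_right [Finite V] (h : Routed r neg N) {i j : V} (hij : r i j) (hlt : i < j)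
    (v a b : V) (ha : Dbl (Rot r neg i j) neg v a) (hb : Dbl (Rot r neg i j) neg v b)
    (hav : v < a) (hbv : v < b) : a = b := by
  have h0 := h.asymm
  have h1 := fun x => h.not_adj_of_arc (x := x) hij
  have hmi := fun x y => h.movesIn_unique (i := i) (x := x) (y := y)
  have hmo := fun x y => h.movesOut_unique (j := j) (x := x) (y := y)
  have hsi := fun x => h.movesIn_side (x := x) hij
  have hso := fun x => h.movesOut_side (x := x) hij
  have h2 := h.right v
  clear h
  unfold Rot at ha hb
  unfold Dbl at *
  have h3 : ∀ x, MovesIn r neg i x → r x i := fun x h => h.1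
  have h4 : ∀ x, MovesOut r neg j x → r j x := fun x h => h.1
  have h5 : ∀ x, r x i → (MovesIn r neg i x ↔ (neg i → ¬ x < i)) := by
    unfold MovesIn Dbl; grind
  have h6 : ∀ x, r j x → (MovesOut r neg j x ↔ (¬ neg j → ¬ j < x)) := by
    unfold MovesOut Dbl; grind
  generalize MovesIn r neg i = mi at *
  generalize MovesOut r neg j = mo at *
  by_cases hv : neg v <;>
    simp only [hv, true_and, false_and, or_false, false_or, not_true, not_false_eq_true] at ha hb h2
  · rcases ha with ha | ha | ha | ha <;> rcases hb with hb | hb | hb | hb <;> grind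
  · rcases ha with ha | ha | ha | ha <;> rcases hb with hb | hb | hb | hb <;> grind


/-- The labels in the doubled branches after the rotation. Only the branch of `i` through `j` and
that of `j` through `i` have changed: the former consists of `j`, the right subtree of `j` and the
moved subtree of `i`, and all of these are larger than `i` if the branch is doubled; the latter is
symmetric. -/
theorem rot_side [Finite V] (h : Routed r neg N) {i j : V} (hij : r i j) (hlt : i < j) (v u : V)
    (hu : u ≠ v) (hd : Dbl (Rot r neg i j) neg v (rotRoute r neg N i j v u)) :
    rotRoute r neg N i j v u < v ↔ u < v := by
  have h0 := h.asymm
  have h1 := fun x => h.not_adj_of_arc (x := x) hij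
  have hi := fun x => h.movesIn_route (x := x) hij
  have ho := fun x => h.movesOut_route (x := x) hij
  have hsi := fun x => h.movesIn_side (x := x) hij
  have hso := fun x => h.movesOut_side (x := x) hij
  have hc := h.compl i j u hij
  have hself := fun v => h.route_route (v := v) (u := u)
  have hNi := h.self i j (.inl hij)
  have hNj := h.self j i (.inr hij)
  have ha := h.adj
  have hs := h.side
  have hs' := fun v => h.side' (v := v) (u := u)
  have hS := h.single
  have hL := h.left
  have hR := h.right
  clear h
  unfold Rot rotRoute Dbl at *
  unfold Sgl at *
  beta_reduce at hd
  have h3 : ∀ x, MovesIn r neg i x → r x i := fun x h => h.1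
  have h4 : ∀ x, MovesOut r neg j x → r j x := fun x h => h.1
  have h5 : ∀ x, r x i → (MovesIn r neg i x ↔ (neg i → ¬ x < i)) := by
    unfold MovesIn Dbl; grind
  have h6 : ∀ x, r j x → (MovesOut r neg j x ↔ (¬ neg j → ¬ j < x)) := by
    unfold MovesOut Dbl; grind
  generalize MovesIn r neg i = mi at *
  generalize MovesOut r neg j = mo at *
  by_cases hvi : v = i
  · subst hvi
    have := hs v u
    have := hs' v
    have := hs' j
    have := ha v u
    have := ha j u
    have := hS v j (N v u)
    have := hS j v (N j u)
    have := hL j v (N j u)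
    have := h0 j j
    have hn := em (neg j)
    clear hs hs' ha hS hL hR
    rw [if_pos rfl] at hd ⊢
    by_cases h7 : u = j
    · grind
    rw [if_neg h7] at hd ⊢
    by_cases h8 : N v u = j
    · rw [if_pos h8] at hd ⊢
      split_ifs at hd ⊢ <;> rcases hn with hn | hn <;> grind
    · rw [if_neg h8] at hd ⊢
      split_ifs at hd ⊢ <;> grind
  rw [if_neg hvi] at hd ⊢
  by_cases hvj : v = j
  · subst hvj
    have := hs v u
    have := hs' v
    have := hs i u
    have := ha v u
    have := ha i u
    have := hS v i (N v u)
    have := hS i v (N i u)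
    have := hR i v (N i u)
    have := h0 i i
    have hn := em (neg i)
    clear hs hs' ha hS hL hR
    rw [if_pos rfl] at hd ⊢
    by_cases h7 : u = i
    · grind
    rw [if_neg h7] at hd ⊢
    by_cases h8 : N v u = i
    · rw [if_pos h8] at hd ⊢
      split_ifs at hd ⊢ <;> rcases hn with hn | hn <;> grind
    · rw [if_neg h8] at hd ⊢
      split_ifs at hd ⊢ <;> grind
  rw [if_neg hvj] at hd ⊢
  have := hs v u
  have := ha v u
  clear hs hs' ha hS hL hR
  split_ifs at hd ⊢ <;> grind

/-- A rotation of an arc `i → j` with `i < j` yields a Cambrian tree of the same signature. -/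
theorem rot [Finite V] (h : Routed r neg N) {i j : V} (hij : r i j) (hlt : i < j) :
    Routed (Rot r neg i j) neg (rotRoute r neg N i j) where
  asymm := h.rot_asymm hij
  adj := h.rot_adj hij
  self := h.rot_self hij
  compl := h.rot_compl hij
  single := h.rot_single hij
  left := h.rot_left hij hlt
  right := h.rot_right hij hlt
  side := h.rot_side hij hlt

end Routed
end Cambrian

namespace Cambrian

/-! ### The tree order under rotation -/

namespace Routed

variable {V : Type*} [LinearOrder V] {r : V → V → Prop} {neg : V → Prop} {N : V → V → V}

/-- The effect on the tree order of a rotation of `i → j`. A path of the new tree that uses the new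
arc `j → i` and is not a relation of the old tree runs from `j` or its right subtree to `i` or its
left subtree, hence decreases the label. -/
theorem reflTransGen_of_rot [Finite V] (h : Routed r neg N) {i j : V} (hij : r i j) (hlt : i < j)
    {r' : V → V → Prop} (hr' : ∀ x y, r' x y → (x = j ∧ y = i) ∨ (y = j ∧ r x i) ∨
      (x = i ∧ r j y) ∨ (r x y ∧ ¬ (x = i ∧ y = j))) {a b : V}
    (hab : Relation.ReflTransGen r' a b) : Relation.ReflTransGen r a b ∨
      ((a = j ∨ (neg j ∧ a ≠ j ∧ r (N j a) j ∧ j < a)) ∧ b ≤ i ∧ Relation.ReflTransGen r i b) := by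
  induction hab using Relation.ReflTransGen.head_induction_on with
  | refl => exact .inl .refl
  | @head a x hax _ ih =>
    rcases hr' a x hax with ⟨rfl, rfl⟩ | ⟨rfl, h1⟩ | ⟨rfl, h1⟩ | ⟨h1, h2⟩
    · rcases ih with ih | ⟨_, h3, h4⟩
      · rcases ih.cases_head with rfl | ⟨y, hy, hyb⟩
        · exact .inr ⟨.inl rfl, le_rfl, .refl⟩
        · by_cases hya : y = a
          · exact .inl (hya ▸ hyb)
          · have hx : ¬ neg x := fun hx => hya (h.single x y a (.inl ⟨hx, hy⟩) (.inl ⟨hx, hij⟩))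
            have hyx : y < x := lt_of_le_of_ne (not_lt.1 fun h5 => hya
              (h.right x y a (.inr ⟨hx, hy⟩) (.inr ⟨hx, hij⟩) h5 hlt)) (h.ne_of_adj hy).symm
            obtain ⟨h6, h7⟩ := h.route_of_path hy hyb
            have h8 := h.side x b h6 (.inr ⟨hx, by rwa [h7]⟩)
            exact .inr ⟨.inl rfl, (h8.1 (by rwa [h7])).le, ih⟩
      · exact .inr ⟨.inl rfl, h3, h4⟩
    · left
      rcases ih with ih | ⟨_, _, h4⟩
      · exact .head h1 (.head hij ih)
      · exact .head h1 h4
    · left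
      rcases ih with ih | ⟨_, _, h4⟩
      · exact .head hij (.head h1 ih)
      · exact h4
    · rcases ih with ih | ⟨h3, h4, h5⟩
      · exact .inl (.head h1 ih)
      · right
        refine ⟨?_, h4, h5⟩
        rcases h3 with rfl | ⟨hj, hxj, h6, h7⟩
        · have hai : a ≠ i := fun hai => h2 ⟨hai, rfl⟩
          have hn : neg x := by
            by_contra hn
            exact hai (h.single x a i (.inr ⟨hn, h1⟩) (.inr ⟨hn, hij⟩))
          have hax := h.ne_of_adj h1
          refine .inr ⟨hn, hax, by rwa [h.self _ _ (.inr h1)], ?_⟩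
          exact lt_of_le_of_ne (not_lt.1 fun h5 => hai
            (h.left x a i (.inl ⟨hn, h1⟩) (.inl ⟨hn, hij⟩) h5 hlt)) hax.symm
        · by_cases haj : a = j
          · exact .inl haj
          · have hN := h.route_congr (.inl h1) j haj hxj
            refine .inr ⟨hj, haj, by rwa [hN], (h.side' haj (.inl ⟨hj, by rwa [hN]⟩)).1 ?_⟩
            rw [hN]
            exact (h.side' hxj (.inl ⟨hj, h6⟩)).2 h7

/-- A rotation of `i → j` creates no relation `a ≺ b` with `a < b`. -/
theorem transGen_of_rot [Finite V] (h : Routed r neg N) {i j : V} (hij : r i j) (hlt : i < j)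
    {r' : V → V → Prop} (hr' : ∀ x y, r' x y → (x = j ∧ y = i) ∨ (y = j ∧ r x i) ∨
      (x = i ∧ r j y) ∨ (r x y ∧ ¬ (x = i ∧ y = j))) {a b : V} (hlt' : a < b)
    (hab : Relation.TransGen r' a b) : Relation.TransGen r a b := by
  rcases h.reflTransGen_of_rot hij hlt hr' hab.to_reflTransGen with h1 | ⟨h1, h2, _⟩
  · exact (Relation.reflTransGen_iff_eq_or_transGen.1 h1).resolve_left hlt'.ne'
  · have : j ≤ a := by
      rcases h1 with h1 | h1
      · exact h1.ge
      · exact h1.2.2.2.le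
    order

/-- Rotating an arc `i → j` only removes relations `a ≺ b` with `a < b`. -/
theorem transGen_of_transGen_rot [Finite V] (h : Routed r neg N) {i j : V} (hij : r i j)
    (hlt : i < j) {a b : V} (hlt' : a < b) (hab : Relation.TransGen (Rot r neg i j) a b) :
    Relation.TransGen r a b := by
  refine h.transGen_of_rot hij hlt (fun x y hxy => ?_) hlt' hab
  unfold Rot MovesIn MovesOut at hxy
  tauto

/-- Rotating an arc `i → j` keeps the relations `a ≺ b` with `b < a`: the rotation is undone by the
rotation of `j → i` for the reversed order of the labels. -/
theorem transGen_rot_of_transGen [Finite V] (h : Routed r neg N) {i j : V} (hij : r i j)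
    (hlt : i < j) {a b : V} (hlt' : b < a) (hab : Relation.TransGen r a b) :
    Relation.TransGen (Rot r neg i j) a b := by
  refine (h.rot hij hlt).dual.transGen_of_rot (i := j) (j := i) (.inl ⟨rfl, rfl⟩) hlt
    (fun x y hxy => ?_) hlt' hab
  have := h.asymm x y hxy
  have := h.asymm i j hij
  unfold Rot
  by_cases hx : x = i ∧ y = j
  · exact .inl hx
  by_cases h1 : y = i ∧ MovesIn r neg i x
  · exact .inr (.inl ⟨h1.1, .inr (.inl ⟨rfl, h1.2⟩)⟩)
  by_cases h2 : x = j ∧ MovesOut r neg j y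
  · exact .inr (.inr (.inl ⟨h2.1, .inr (.inr (.inl ⟨rfl, h2.2⟩))⟩))
  · refine .inr (.inr (.inr ⟨.inr (.inr (.inr ⟨hxy, hx, h1, h2⟩)), ?_⟩))
    rintro ⟨rfl, rfl⟩
    contradiction

end Routed
end Cambrian

namespace Cambrian

/-! ### Routing functions of directed trees -/

section Bridge

variable {V : Type*} {D : Digraph V}

theorem adj_inclusive_iff (hD : ∀ a b, D.Adj a b → ¬ D.Adj b a) {a b : V} :
    D.toSimpleGraphInclusive.Adj a b ↔ D.Adj a b ∨ D.Adj b a := by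
  simp only [Digraph.toSimpleGraphInclusive, SimpleGraph.fromRel_adj]
  constructor
  · exact fun h => h.2
  · refine fun h => ⟨?_, h⟩
    rintro rfl
    rcases h with h | h <;> exact hD _ _ h h

open SimpleGraph in
theorem exists_path_of_mem_branch {v a u : V} (hu : u ∈ branch D v a) :
    ∃ p : D.toSimpleGraphInclusive.Walk a u, p.IsPath ∧ v ∉ p.support := by
  classical
  obtain ⟨p, hp⟩ := hu
  exact ⟨p.bypass, p.bypass_isPath, fun h => hp (p.support_bypass_subset_support h)⟩

open SimpleGraph in
theorem branch_disjoint (hD : D.toSimpleGraphInclusive.IsAcyclic) {v a b u : V}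
    (ha : D.toSimpleGraphInclusive.Adj v a) (hb : D.toSimpleGraphInclusive.Adj v b)
    (hua : u ∈ branch D v a) (hub : u ∈ branch D v b) : a = b := by
  obtain ⟨p, hp, hvp⟩ := exists_path_of_mem_branch hua
  obtain ⟨q, hq, hvq⟩ := exists_path_of_mem_branch hub
  have h1 : (Walk.cons ha p).IsPath := (Walk.cons_isPath_iff _ _).2 ⟨hp, hvp⟩
  have h2 : (Walk.cons hb q).IsPath := (Walk.cons_isPath_iff _ _).2 ⟨hq, hvq⟩
  have h3 := (hD.subsingleton_path _ _).elim ⟨_, h1⟩ ⟨_, h2⟩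
  have h4 := congrArg (fun p => p.1.snd) h3
  simpa using h4

open SimpleGraph in
theorem exists_mem_branch (hD : D.toSimpleGraphInclusive.Preconnected) {v u : V} (hu : u ≠ v) :
    ∃ a, D.toSimpleGraphInclusive.Adj v a ∧ u ∈ branch D v a := by
  classical
  obtain ⟨p⟩ := hD v u
  have hp := p.bypass_isPath
  cases hq : p.bypass with
  | nil => exact (hu rfl).elim
  | @cons _ a _ h q =>
    rw [hq] at hp
    exact ⟨a, h, q, ((Walk.cons_isPath_iff _ _).1 hp).2⟩

open SimpleGraph in
theorem mem_branch_compl (hD : IsDirectedTree D) {a b u : V}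
    (hab : D.toSimpleGraphInclusive.Adj a b) : u ∈ branch D a b ↔ u ∉ branch D b a := by
  classical
  constructor
  · intro h1 h2
    obtain ⟨p, hp, hap⟩ := exists_path_of_mem_branch h1
    obtain ⟨q, hq, hbq⟩ := exists_path_of_mem_branch h2
    have h3 : (Walk.cons hab p).IsPath := (Walk.cons_isPath_iff _ _).2 ⟨hp, hap⟩
    have h4 := (hD.2.2.subsingleton_path _ _).elim ⟨_, h3⟩ ⟨_, hq⟩
    have h5 : q = Walk.cons hab p := (congrArg Subtype.val h4).symm
    exact hbq (by rw [h5]; simp)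
  · intro h1
    obtain ⟨p⟩ := hD.2.1 a u
    have hb : b ∈ p.bypass.support := by
      by_contra hb
      exact h1 ⟨_, hb⟩
    have hp := p.bypass_isPath
    refine ⟨p.bypass.dropUntil b hb, fun ha => ?_⟩
    have h2 := p.bypass.take_spec hb
    have h3 := hp.support_nodup
    rw [← h2, Walk.support_append, List.nodup_append] at h3
    rw [Walk.mem_support_iff] at ha
    rcases ha with ha | ha
    · exact hab.ne ha
    · exact h3.2.2 a (Walk.start_mem_support _) a ha rfl

end Bridge

variable {n : ℕ} {ε : Fin n → ℤˣ} {D : Digraph (Fin n)}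

/-- The negative vertices of a signature. -/
def IsNeg (ε : Fin n → ℤˣ) (v : Fin n) : Prop := ε v = -1

theorem mem_doubled_iff {v a : Fin n} : a ∈ doubled ε D v ↔ Dbl D.Adj (IsNeg ε) v a := by
  unfold doubled Dbl IsNeg
  split_ifs with h <;> simp [h, children, parents]

theorem mem_single_iff {v a : Fin n} : a ∈ single ε D v ↔ Sgl D.Adj (IsNeg ε) v a := by
  unfold single Sgl IsNeg
  split_ifs with h <;> simp [h, children, parents]

/-- Every Cambrian tree has a routing function. -/
theorem IsCambrian.exists_routed (h : IsCambrian ε D) : ∃ N, Routed D.Adj (IsNeg ε) N := by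
  classical
  obtain ⟨hD, hv⟩ := h
  have hadj := fun a b => adj_inclusive_iff hD.1 (a := a) (b := b)
  choose! N hN using fun v u (hu : u ≠ v) => exists_mem_branch hD.2.1 hu
  have hne : ∀ v a u, D.Adj v a ∨ D.Adj a v → u ∈ branch D v a → u ≠ v := by
    rintro v a _ _ ⟨p, hp⟩ rfl
    exact hp p.end_mem_support
  have hmem : ∀ v a u, D.Adj v a ∨ D.Adj a v → (u ∈ branch D v a ↔ u ≠ v ∧ N v u = a) := by
    refine fun v a u hva => ⟨fun hu => ?_, ?_⟩
    · have huv := hne v a u hva hu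
      exact ⟨huv, branch_disjoint hD.2.2 (hN v u huv).1 ((hadj _ _).2 hva) (hN v u huv).2 hu⟩
    · rintro ⟨huv, rfl⟩
      exact (hN v u huv).2
  have hadjN : ∀ v u, u ≠ v → D.Adj v (N v u) ∨ D.Adj (N v u) v := fun v u hu =>
    (hadj _ _).1 (hN v u hu).1
  have hDne : ∀ v a, Dbl D.Adj (IsNeg ε) v a → a ≠ v := by
    rintro v _ (⟨_, ha⟩ | ⟨_, ha⟩) rfl <;> exact hD.1 _ _ ha ha
  refine ⟨N, hD.1, hadjN, ?_, ?_, ?_, ?_, ?_, ?_⟩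
  · intro v a hva
    have hav : a ≠ v := by rintro rfl; rcases hva with h | h <;> exact hD.1 _ _ h h
    refine ((hmem v a a hva).1 ⟨.nil, ?_⟩).2
    simpa using hav.symm
  · intro a b u hab hua hub
    have h1 := hmem a b u (.inl hab)
    have h2 := hmem b a u (.inr hab)
    have h3 := mem_branch_compl hD (u := u) ((hadj _ _).2 (.inl hab))
    tauto
  · exact fun v a b ha hb => (hv v).1 (mem_single_iff.2 ha) (mem_single_iff.2 hb)
  · exact fun v a b ha hb hav hbv =>
      (hv v).2.1 ⟨mem_doubled_iff.2 ha, hav⟩ ⟨mem_doubled_iff.2 hb, hbv⟩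
  · exact fun v a b ha hb hav hbv =>
      (hv v).2.2.1 ⟨mem_doubled_iff.2 ha, hav⟩ ⟨mem_doubled_iff.2 hb, hbv⟩
  · intro v u hu hd
    have hb := (hmem v _ u (hadjN v u hu)).2 ⟨hu, rfl⟩
    have hlt : N v u < v → u < v := fun hlt =>
      (hv v).2.2.2.1 u ⟨_, ⟨mem_doubled_iff.2 hd, hlt⟩, hb⟩
    have hgt : v < N v u → v < u := fun hgt =>
      (hv v).2.2.2.2 u ⟨_, ⟨mem_doubled_iff.2 hd, hgt⟩, hb⟩
    have := hDne _ _ hd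
    exact ⟨hlt, fun h1 => lt_of_le_of_ne (not_lt.1 fun h2 => lt_asymm h1 (hgt h2)) this⟩

namespace Routed

variable {N : Fin n → Fin n → Fin n}

open SimpleGraph in
theorem mem_branch_iff (h : Routed D.Adj (IsNeg ε) N) {v a u : Fin n}
    (hva : D.Adj v a ∨ D.Adj a v) : u ∈ branch D v a ↔ u ≠ v ∧ N v u = a := by
  have hadj := fun a b => adj_inclusive_iff h.asymm (a := a) (b := b)
  have hav : a ≠ v := by rintro rfl; rcases hva with h1 | h1 <;> exact h.asymm _ _ h1 h1
  constructor
  · rintro ⟨p, hp⟩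
    have key : ∀ {x y : Fin n} (p : D.toSimpleGraphInclusive.Walk x y), v ∉ p.support →
        y ≠ v ∧ N v y = N v x := by
      intro x y p
      induction p with
      | nil => intro hp; simp at hp; exact ⟨Ne.symm hp, rfl⟩
      | @cons x y z hxy p ih =>
        intro hp
        simp only [Walk.support_cons, List.mem_cons, not_or] at hp
        obtain ⟨h1, h2⟩ := ih hp.2
        have hyv : y ≠ v := fun hyv => hp.2 (hyv ▸ p.start_mem_support)
        exact ⟨h1, h2.trans (h.route_congr ((hadj _ _).1 hxy) v (Ne.symm hp.1) hyv).symm⟩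
    obtain ⟨h1, h2⟩ := key p hp
    exact ⟨h1, h2.trans (h.self _ _ hva)⟩
  · rintro ⟨huv, rfl⟩
    clear hva hav
    revert huv
    refine h.induct_toward v (p := fun u => u ≠ v → u ∈ branch D v (N v u))
      (fun hx => (hx rfl).elim) (fun u _ ih huv => ?_) u
    have hadjw := h.adj u v huv.symm
    by_cases hw : N u v = v
    · rw [hw] at hadjw
      rw [h.self _ _ hadjw.symm]
      exact ⟨.nil, by simpa using huv.symm⟩
    · obtain ⟨p, hp⟩ := ih hw
      have hN := h.route_congr hadjw v huv hw
      rw [hN]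
      refine ⟨p.concat ((hadj _ _).2 hadjw.symm), ?_⟩
      rw [Walk.support_concat]
      simp [hp, huv.symm]

open SimpleGraph in
theorem isDirectedTree (h : Routed D.Adj (IsNeg ε) N) : IsDirectedTree D := by
  have hadj := fun a b => adj_inclusive_iff h.asymm (a := a) (b := b)
  refine ⟨h.asymm, fun a b => ?_, ?_⟩
  · refine h.induct_toward b (p := fun a => D.toSimpleGraphInclusive.Reachable a b) (.refl _)
      (fun v hv ih => ?_) a
    exact ((hadj _ _).2 (h.adj v b hv.symm)).reachable.trans ih
  · rw [isAcyclic_iff_forall_adj_isBridge]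
    intro v w hvw
    rw [isBridge_iff]
    rintro ⟨p⟩
    -- a walk from `w` that avoids the edge `v — w` never leaves the branch of `v` at `w`
    have key : ∀ {x y : Fin n} (_ : (D.toSimpleGraphInclusive \ fromEdgeSet {s(v, w)}).Walk x y),
        x ≠ v → N v x = w → y ≠ v ∧ N v y = w := by
      intro x y p
      induction p with
      | nil => exact fun h1 h2 => ⟨h1, h2⟩
      | @cons x y z hxy p ih =>
        intro h1 h2
        have hxy' : D.toSimpleGraphInclusive.Adj x y := hxy.1
        have hyv : y ≠ v := by
          rintro rfl
          rw [h.self _ _ ((hadj _ _).1 hxy'.symm)] at h2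
          subst h2
          exact hxy.2 (by simp [hxy'.ne, Sym2.eq_swap])
        exact ih hyv ((h.route_congr ((hadj _ _).1 hxy') v h1 hyv).symm.trans h2)
    exact (key p.reverse hvw.ne.symm (h.self _ _ ((hadj _ _).1 hvw))).1 rfl

theorem mem_leftSubtree_iff (h : Routed D.Adj (IsNeg ε) N) {v u : Fin n} :
    u ∈ leftSubtree ε D v ↔ u ≠ v ∧ Dbl D.Adj (IsNeg ε) v (N v u) ∧ N v u < v := by
  constructor
  · rintro ⟨a, ⟨h1, h2⟩, h3⟩
    rw [mem_doubled_iff] at h1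
    obtain ⟨h4, rfl⟩ := (h.mem_branch_iff (by unfold Dbl at h1; tauto)).1 h3
    exact ⟨h4, h1, h2⟩
  · rintro ⟨h1, h2, h3⟩
    exact ⟨_, ⟨mem_doubled_iff.2 h2, h3⟩, (h.mem_branch_iff (h.adj v u h1)).2 ⟨h1, rfl⟩⟩

theorem mem_rightSubtree_iff (h : Routed D.Adj (IsNeg ε) N) {v u : Fin n} :
    u ∈ rightSubtree ε D v ↔ u ≠ v ∧ Dbl D.Adj (IsNeg ε) v (N v u) ∧ v < N v u := by
  constructor
  · rintro ⟨a, ⟨h1, h2⟩, h3⟩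
    rw [mem_doubled_iff] at h1
    obtain ⟨h4, rfl⟩ := (h.mem_branch_iff (by unfold Dbl at h1; tauto)).1 h3
    exact ⟨h4, h1, h2⟩
  · rintro ⟨h1, h2, h3⟩
    exact ⟨_, ⟨mem_doubled_iff.2 h2, h3⟩, (h.mem_branch_iff (h.adj v u h1)).2 ⟨h1, rfl⟩⟩

theorem isCambrian (h : Routed D.Adj (IsNeg ε) N) : IsCambrian ε D := by
  refine ⟨h.isDirectedTree, fun v => ⟨?_, ?_, ?_, ?_, ?_⟩⟩
  · exact fun a ha b hb => h.single v a b (mem_single_iff.1 ha) (mem_single_iff.1 hb)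
  · exact fun a ha b hb =>
      h.left v a b (mem_doubled_iff.1 ha.1) (mem_doubled_iff.1 hb.1) ha.2 hb.2
  · exact fun a ha b hb =>
      h.right v a b (mem_doubled_iff.1 ha.1) (mem_doubled_iff.1 hb.1) ha.2 hb.2
  · intro u hu
    obtain ⟨h1, h2, h3⟩ := h.mem_leftSubtree_iff.1 hu
    exact (h.side v u h1 h2).1 h3
  · intro u hu
    obtain ⟨h1, h2, h3⟩ := h.mem_rightSubtree_iff.1 hu
    exact (h.side' h1 h2).1 h3

end Routed

theorem CambrianTree.exists_routed (T : CambrianTree ε) : ∃ N, Routed T.1.Adj (IsNeg ε) N :=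
  IsCambrian.exists_routed T.2

end Cambrian

namespace Cambrian

/-! ### Grafting -/

/-- `p` carries the rightmost outgoing leaf: `IsRightmostOutgoing` in terms of routes. -/
def FreeRight {V : Type*} [LinearOrder V] (r : V → V → Prop) (neg : V → Prop) (N : V → V → V)
    (p : V) : Prop :=
  (∀ b, r p b → ¬ neg p ∧ b < p) ∧ ∀ w, p ≠ w → Dbl r neg w (N w p) → ¬ N w p < w

namespace Routed

section Free

variable {V : Type*} [LinearOrder V] {r : V → V → Prop} {neg : V → Prop} {N : V → V → V}

/-- There is a rightmost outgoing leaf: a highest vertex among those in no left subtree. -/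
theorem exists_freeRight [Finite V] [Nonempty V] (h : Routed r neg N) :
    ∃ p, FreeRight r neg N p := by
  obtain ⟨s, hs⟩ := h.exists_height
  let X : Set V := {p | ∀ w, p ≠ w → Dbl r neg w (N w p) → ¬ N w p < w}
  have hX : X.Nonempty := by
    obtain ⟨m, hm⟩ := Finite.exists_max (id : V → V)
    exact ⟨m, fun w hw hd hlt => absurd ((h.side w m hw hd).1 hlt) (not_lt.2 (hm w))⟩
  obtain ⟨p, hp, hmax⟩ := Set.exists_max_image X s X.toFinite hX
  refine ⟨p, fun b hb => ?_, hp⟩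
  by_contra hcon
  have hpb := h.ne_of_adj hb
  refine absurd (hs p b hb) (not_lt.2 (hmax b fun w hw hd hlt => ?_))
  by_cases hpw : p = w
  · subst hpw
    rw [h.self _ _ (.inl hb)] at hd hlt
    rcases hd with ⟨_, hd⟩ | ⟨hd, _⟩
    · exact h.asymm _ _ hb hd
    · exact hcon ⟨hd, hlt⟩
  · rw [← h.route_congr (.inl hb) w hpw hw] at hd hlt
    exact hp w hpw hd hlt

theorem adj_route_of_freeRight (h : Routed r neg N) {p p' : V} (hp : FreeRight r neg N p)
    (hp' : FreeRight r neg N p') (hne : p ≠ p') : r (N p p') p := by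
  refine (h.adj p p' hne.symm).resolve_left fun h1 => ?_
  obtain ⟨h2, h3⟩ := hp.1 _ h1
  exact hp'.2 p hne.symm (.inr ⟨h2, h1⟩) h3

/-- The rightmost outgoing leaf is unique: the path between two candidates would leave both of them
downwards, hence would turn at a positive vertex with one of them in its left subtree. -/
theorem freeRight_unique [Finite V] (h : Routed r neg N) {p p' : V} (hp : FreeRight r neg N p)
    (hp' : FreeRight r neg N p') : p = p' := by
  by_contra hne
  have h1 := h.adj_route_of_freeRight hp hp' hne
  have h2 := h.adj_route_of_freeRight hp' hp (Ne.symm hne)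
  rcases h.flip.up_or_between hne h1 with h3 | ⟨b, hpb, hb, hb', h3, h4, h5, h6⟩
  · have h3 := h.adj_route_of_transGen (Relation.transGen_swap.1 h3)
    exact h.asymm _ _ h2 h3.2
  · have hpb' := (h.flip.adj_route_of_transGen hpb).1.symm
    rcases h6 with ⟨h6, _⟩ | ⟨h6, _⟩
    · exact hp.2 b hpb' (.inr ⟨hb, h3⟩) ((h.side b p hpb' (.inr ⟨hb, h3⟩)).2 h6)
    · exact hp'.2 b hb' (.inr ⟨hb, h4⟩) ((h.side b p' hb' (.inr ⟨hb, h4⟩)).2 h6)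

/-- The vertex carrying the rightmost outgoing leaf, as a constant function, so that the empty tree
is allowed. -/
theorem exists_freeRight_iff [Finite V] (h : Routed r neg N) :
    ∃ p : V → V, ∀ x a, FreeRight r neg N a ↔ a = p x := by
  rcases isEmpty_or_nonempty V with hV | hV
  · exact ⟨id, fun x => (hV.false x).elim⟩
  · obtain ⟨p, hp⟩ := h.exists_freeRight
    refine ⟨fun _ => p, fun _ a => ⟨fun ha => h.freeRight_unique ha hp, ?_⟩⟩
    rintro rfl
    exact hp

end Free

end Routed

section Union

variable {n n' : ℕ} {D : Digraph (Fin n)} {D' : Digraph (Fin n')} {up : Fin n → Fin n' → Prop}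
  {down : Fin n' → Fin n → Prop}

theorem castAdd_ne_natAdd (a : Fin n) (b : Fin n') : Fin.castAdd n' a ≠ Fin.natAdd n b := by
  simp [Fin.ext_iff]
  omega

theorem natAdd_ne_castAdd (a : Fin n) (b : Fin n') : Fin.natAdd n b ≠ Fin.castAdd n' a :=
  (castAdd_ne_natAdd a b).symm

theorem castAdd_lt_natAdd (a : Fin n) (b : Fin n') : Fin.castAdd n' a < Fin.natAdd n b := by
  simp [Fin.lt_def]
  omega

theorem not_natAdd_lt_castAdd (a : Fin n) (b : Fin n') :
    ¬ Fin.natAdd n b < Fin.castAdd n' a :=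
  lt_asymm (castAdd_lt_natAdd a b)

theorem castAdd_lt_castAdd (a b : Fin n) : Fin.castAdd n' a < Fin.castAdd n' b ↔ a < b := .rfl

@[simp] theorem shiftedUnion_cast_cast {a b : Fin n} :
    (shiftedUnion D D' up down).Adj (Fin.castAdd n' a) (Fin.castAdd n' b) ↔ D.Adj a b := by
  simp [shiftedUnion, castAdd_ne_natAdd]

@[simp] theorem shiftedUnion_nat_nat {a b : Fin n'} :
    (shiftedUnion D D' up down).Adj (Fin.natAdd n a) (Fin.natAdd n b) ↔ D'.Adj a b := by
  simp [shiftedUnion, natAdd_ne_castAdd]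

@[simp] theorem shiftedUnion_cast_nat {a : Fin n} {b : Fin n'} :
    (shiftedUnion D D' up down).Adj (Fin.castAdd n' a) (Fin.natAdd n b) ↔ up a b := by
  simp [shiftedUnion, castAdd_ne_natAdd, natAdd_ne_castAdd]

@[simp] theorem shiftedUnion_nat_cast {a : Fin n} {b : Fin n'} :
    (shiftedUnion D D' up down).Adj (Fin.natAdd n b) (Fin.castAdd n' a) ↔ down b a := by
  simp [shiftedUnion, castAdd_ne_natAdd, natAdd_ne_castAdd]

end Union

/-- The routing function of a tree grafted from two trees by an arc between `p` and `q`, where `p`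
and `q` are given as constant functions. -/
def graftRoute {n n' : ℕ} (N : Fin n → Fin n → Fin n) (N' : Fin n' → Fin n' → Fin n')
    (p : Fin n → Fin n) (q : Fin n' → Fin n') (v u : Fin (n + n')) : Fin (n + n') :=
  Fin.addCases
    (fun v => Fin.addCases (fun u => Fin.castAdd n' (N v u))
      (fun u => if v = p v then Fin.natAdd n (q u) else Fin.castAdd n' (N v (p v))) u)
    (fun v => Fin.addCases (fun u => if v = q v then Fin.castAdd n' (p u) else
      Fin.natAdd n (N' v (q v))) (fun u => Fin.natAdd n (N' v u)) u) v

namespace Routed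

/-- Grafting the rightmost outgoing leaf of `D` on the leftmost incoming leaf of the shifted `D'`.
The choice of leaves matters for the labels only: no left subtree of `D` and no right subtree of
`D'` grows. -/
theorem graft {n n' : ℕ} {D : Digraph (Fin n)} {D' : Digraph (Fin n')} {neg : Fin n → Prop}
    {neg' : Fin n' → Prop} {N : Fin n → Fin n → Fin n} {N' : Fin n' → Fin n' → Fin n'}
    (h : Routed D.Adj neg N) (h' : Routed D'.Adj neg' N') {p : Fin n → Fin n} {q : Fin n' → Fin n'}
    (hp : ∀ x a, FreeRight D.Adj neg N a ↔ a = p x)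
    (hq : ∀ x b, FreeRight (V := (Fin n')ᵒᵈ) (fun a b => D'.Adj b a) (fun v => ¬ neg' v) N' b ↔
      b = q x) {up : Fin n → Fin n' → Prop} (hup : ∀ a b, up a b ↔ a = p a ∧ b = q b) :
    Routed (shiftedUnion D D' up fun _ _ => False).Adj (Fin.append neg neg')
      (graftRoute N N' p q) := by
  have hpp : ∀ x y, p x = p y := fun x y => (hp y _).1 ((hp x _).2 rfl)
  have hqq : ∀ x y, q x = q y := fun x y => (hq y _).1 ((hq x _).2 rfl)
  have hpu : ∀ x b, D.Adj (p x) b → ¬ neg (p x) ∧ b < p x := fun x => ((hp x _).2 rfl).1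
  have hpl : ∀ x w, p x ≠ w → Dbl D.Adj neg w (N w (p x)) → ¬ N w (p x) < w :=
    fun x => ((hp x _).2 rfl).2
  have hqu : ∀ x a, D'.Adj a (q x) → neg' (q x) ∧ q x < a := fun x a ha => by
    obtain ⟨h1, h2⟩ := ((hq x _).2 rfl).1 a ha
    exact ⟨not_not.1 h1, h2⟩
  have hql : ∀ x w, q x ≠ w → Dbl D'.Adj neg' w (N' w (q x)) → ¬ w < N' w (q x) :=
    fun x w hw hd => ((hq x _).2 rfl).2 w hw (by unfold Dbl at *; tauto)
  clear hp hq
  unfold Dbl at hpl hql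
  refine ⟨?_, ?_, ?_, ?_, ?_, ?_, ?_, ?_⟩
  · intro a b
    have := h.asymm
    have := h'.asymm
    induction a using Fin.addCases <;> induction b using Fin.addCases <;> simp <;> grind
  · intro v u
    have := h.adj
    have := h'.adj
    induction v using Fin.addCases <;> induction u using Fin.addCases <;>
      simp [graftRoute, castAdd_ne_natAdd, natAdd_ne_castAdd] <;> (try split_ifs) <;>
      (try simp) <;> grind
  · intro v a
    have := h.self
    have := h'.self
    induction v using Fin.addCases <;> induction a using Fin.addCases <;>
      simp [graftRoute] <;> grind
  · intro a b u
    have := h.compl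
    have := h'.compl
    have := h.self
    have := h'.self
    have := h.asymm
    have := h'.asymm
    induction a using Fin.addCases <;> induction b using Fin.addCases <;>
      induction u using Fin.addCases <;>
      simp [graftRoute, castAdd_ne_natAdd, natAdd_ne_castAdd] <;> grind
  · intro v a b
    have := h.single
    have := h'.single
    unfold Sgl at *
    induction v using Fin.addCases <;> induction a using Fin.addCases <;>
      induction b using Fin.addCases <;> simp [castAdd_ne_natAdd, natAdd_ne_castAdd] <;> grind
  · intro v a b
    have := h.left
    have := h'.left
    unfold Dbl at *
    induction v using Fin.addCases <;> induction a using Fin.addCases <;>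
      induction b using Fin.addCases <;>
      simp [castAdd_lt_castAdd, castAdd_lt_natAdd, not_natAdd_lt_castAdd] <;> grind
  · intro v a b
    have := h.right
    have := h'.right
    unfold Dbl at *
    induction v using Fin.addCases <;> induction a using Fin.addCases <;>
      induction b using Fin.addCases <;>
      simp [castAdd_lt_castAdd, castAdd_lt_natAdd, not_natAdd_lt_castAdd] <;> grind
  · intro v u
    have := h.side
    have := h'.side
    have := fun v u => h.route_ne (v := v) (u := u)
    have := fun v u => h'.route_ne (v := v) (u := u)
    unfold Dbl at *
    induction v using Fin.addCases <;> induction u using Fin.addCases <;>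
      simp [graftRoute, castAdd_ne_natAdd, natAdd_ne_castAdd] <;> (try split_ifs) <;>
      (try simp [castAdd_lt_castAdd, castAdd_lt_natAdd, not_natAdd_lt_castAdd]) <;> grind

end Routed
end Cambrian

namespace Cambrian

variable {n n' : ℕ} {ε : Fin n → ℤˣ} {ε' : Fin n' → ℤˣ}

theorem eq_one_iff_not_isNeg {v : Fin n} : ε v = 1 ↔ ¬ IsNeg ε v := by
  unfold IsNeg
  rcases Int.units_eq_one_or (ε v) with h | h <;> simp [h]

theorem isNeg_append : IsNeg (Fin.append ε ε') = Fin.append (IsNeg ε) (IsNeg ε') := by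
  funext v
  induction v using Fin.addCases <;> simp [IsNeg]

namespace Routed

variable {D : Digraph (Fin n)} {N : Fin n → Fin n → Fin n}

theorem isRightmostOutgoing_iff (h : Routed D.Adj (IsNeg ε) N) {v : Fin n} :
    IsRightmostOutgoing ε D v ↔ FreeRight D.Adj (IsNeg ε) N v := by
  simp only [IsRightmostOutgoing, FreeRight, h.mem_leftSubtree_iff, eq_one_iff_not_isNeg]
  simp only [not_and]

theorem isRightmostIncoming_iff (h : Routed D.Adj (IsNeg ε) N) {v : Fin n} :
    IsRightmostIncoming ε D v ↔
      FreeRight (fun a b => D.Adj b a) (fun v => ¬ IsNeg ε v) N v := by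
  simp only [IsRightmostIncoming, FreeRight, h.mem_leftSubtree_iff]
  unfold Dbl
  simp only [not_and, not_not, IsNeg, Or.comm]

theorem isLeftmostOutgoing_iff (h : Routed D.Adj (IsNeg ε) N) {v : Fin n} :
    IsLeftmostOutgoing ε D v ↔ FreeRight (V := (Fin n)ᵒᵈ) D.Adj (IsNeg ε) N v := by
  simp only [IsLeftmostOutgoing, h.mem_rightSubtree_iff, eq_one_iff_not_isNeg]
  simp only [not_and]
  rfl

theorem isLeftmostIncoming_iff (h : Routed D.Adj (IsNeg ε) N) {v : Fin n} :
    IsLeftmostIncoming ε D v ↔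
      FreeRight (V := (Fin n)ᵒᵈ) (fun a b => D.Adj b a) (fun v => ¬ IsNeg ε v) N v := by
  simp only [IsLeftmostIncoming, h.mem_rightSubtree_iff]
  unfold FreeRight Dbl
  simp only [not_and, not_not, IsNeg, Or.comm]
  rfl

end Routed

theorem isCambrian_graftUp (T : CambrianTree ε) (T' : CambrianTree ε') :
    IsCambrian (Fin.append ε ε') (graftUp T T') := by
  obtain ⟨N, h⟩ := T.exists_routed
  obtain ⟨N', h'⟩ := T'.exists_routed
  obtain ⟨p, hp⟩ := h.exists_freeRight_iff
  obtain ⟨q, hq⟩ := h'.flip.dual.exists_freeRight_iff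
  have h1 := h.graft h' hp hq
    (up := fun a b => IsRightmostOutgoing ε T.1 a ∧ IsLeftmostIncoming ε' T'.1 b) (fun a b =>
      and_congr (h.isRightmostOutgoing_iff.trans (hp a a))
        (h'.isLeftmostIncoming_iff.trans (hq b b)))
  rw [← isNeg_append] at h1
  exact h1.isCambrian

theorem isCambrian_graftDown (T : CambrianTree ε) (T' : CambrianTree ε') :
    IsCambrian (Fin.append ε ε') (graftDown T T') := by
  obtain ⟨N, h⟩ := T.exists_routed
  obtain ⟨N', h'⟩ := T'.exists_routed
  obtain ⟨p, hp⟩ := h.flip.exists_freeRight_iff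
  obtain ⟨q, hq⟩ := h'.dual.exists_freeRight_iff
  have hq' : ∀ x b, FreeRight (V := (Fin n')ᵒᵈ) (fun a b => T'.1.Adj a b)
      (fun v => ¬ ¬ IsNeg ε' v) N' b ↔ b = q x := by
    simp only [not_not]
    exact hq
  -- the upward grafting of the reversed trees
  have h1 := (Routed.graft (D := ⟨fun a b => T.1.Adj b a⟩) (D' := ⟨fun a b => T'.1.Adj b a⟩)
    h.flip h'.flip hp hq'
    (up := fun a b => IsLeftmostOutgoing ε' T'.1 b ∧ IsRightmostIncoming ε T.1 a) (fun a b =>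
      and_comm.trans (and_congr (h.isRightmostIncoming_iff.trans (hp a a))
        (h'.isLeftmostOutgoing_iff.trans (hq b b))))).flip
  have h2 : (fun v => ¬ Fin.append (fun v => ¬ IsNeg ε v) (fun v => ¬ IsNeg ε' v) v) =
      IsNeg (Fin.append ε ε') := by
    rw [isNeg_append]
    funext v
    induction v using Fin.addCases <;> simp
  rw [h2] at h1
  refine Routed.isCambrian (N := graftRoute N N' p q) ?_
  convert h1 using 1
  funext a b
  induction a using Fin.addCases <;> induction b using Fin.addCases <;> simp [graftDown]

/-! ### Linear extensions along the weak order -/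

theorem rotate_adj_iff {D : Digraph (Fin n)} {i j x y : Fin n} :
    (rotate ε D i j).Adj x y ↔ Rot D.Adj (IsNeg ε) i j x y := by
  simp only [rotate, Rot, MovesIn, MovesOut, leftRoot, rightRoot, Set.mem_ofPred_eq,
    mem_doubled_iff]
  grind

theorem CambrianTree.isCambrian_rotate (S : CambrianTree ε) {i j : Fin n} (hij : S.1.Adj i j)
    (hlt : i < j) : IsCambrian ε (rotate ε S.1 i j) := by
  obtain ⟨N, h⟩ := S.exists_routed
  have h1 := h.rot hij hlt
  refine Routed.isCambrian (N := rotRoute S.1.Adj (IsNeg ε) N i j) ?_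
  convert h1 using 1
  funext x y
  exact propext rotate_adj_iff

/-- Exchanging two values `i < j` at adjacent positions moves a linear extension either to another
linear extension of the same tree or, if `i → j` is an arc, to one of the rotated tree. -/
theorem CambrianTree.exists_of_swap (S : CambrianTree ε) {τ : Equiv.Perm (Fin n)}
    (hτ : IsLinearExtension S.1 τ) {i j : Fin n} (hlt : i < j)
    (hpos : (τ.symm j : ℕ) = τ.symm i + 1) :
    ∃ S' : CambrianTree ε, S ≤ S' ∧ IsLinearExtension S'.1 (Equiv.swap i j * τ) := by
  have hsymm : ∀ x, (Equiv.swap i j * τ).symm x = τ.symm (Equiv.swap i j x) := fun x => by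
    rfl
  have hinj : ∀ x y, (τ.symm x : ℕ) = τ.symm y → x = y := fun x y hxy =>
    τ.symm.injective (Fin.ext hxy)
  have key : ∀ x y, τ.symm x < τ.symm y → ¬ (x = i ∧ y = j) →
      τ.symm (Equiv.swap i j x) < τ.symm (Equiv.swap i j y) := by
    intro x y hxy hne
    have h1 := hinj x i
    have h2 := hinj x j
    have h3 := hinj y i
    have h4 := hinj y j
    rw [Fin.lt_def] at *
    rw [Equiv.swap_apply_def, Equiv.swap_apply_def]
    split_ifs <;> grind
  by_cases hij : S.1.Adj i j
  · refine ⟨⟨_, S.isCambrian_rotate hij hlt⟩, .single ⟨i, j, hlt, hij, rfl⟩, fun a b hab => ?_⟩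
    rw [hsymm, hsymm]
    rw [rotate_adj_iff] at hab
    have hij' := hτ i j hij
    rcases hab with ⟨rfl, rfl⟩ | ⟨rfl, h1⟩ | ⟨rfl, h1⟩ | ⟨h1, h2, _⟩
    · simpa using hij'
    · have h2 := hτ _ _ h1.1
      have h3 : a ≠ i := by rintro rfl; exact lt_irrefl _ h2
      have h4 : a ≠ b := by rintro rfl; exact lt_asymm h2 hij'
      rwa [Equiv.swap_apply_of_ne_of_ne h3 h4, Equiv.swap_apply_right]
    · have h2 := hτ _ _ h1.1
      have h3 : b ≠ j := by rintro rfl; exact lt_irrefl _ h2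
      have h4 : b ≠ a := by rintro rfl; exact lt_asymm h2 hij'
      rwa [Equiv.swap_apply_of_ne_of_ne h4 h3, Equiv.swap_apply_left]
    · exact key a b (hτ a b h1) h2
  · refine ⟨S, le_rfl, fun a b hab => ?_⟩
    rw [hsymm, hsymm]
    refine key a b (hτ a b hab) ?_
    rintro ⟨rfl, rfl⟩
    exact hij hab

theorem strictMono_of_lt_succ {f : Fin n → Fin n}
    (hf : ∀ k (hk : k + 1 < n), f ⟨k, by omega⟩ < f ⟨k + 1, hk⟩) : StrictMono f := by
  cases n with
  | zero => exact fun a => a.elim0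
  | succ n => exact Fin.strictMono_iff_lt_succ.2 fun i => hf i (by omega)

/-- If the inversions of `τ` are inversions of `τ'`, then a tree with linear extension `τ` is below
some tree with linear extension `τ'`. -/
theorem CambrianTree.exists_of_weak_le (S : CambrianTree ε) {τ τ' : Equiv.Perm (Fin n)}
    (hτ : IsLinearExtension S.1 τ)
    (hinv : ∀ a b, a < b → τ.symm b < τ.symm a → τ'.symm b < τ'.symm a) :
    ∃ S' : CambrianTree ε, S ≤ S' ∧ IsLinearExtension S'.1 τ' := by
  classical
  generalize hk : (Finset.univ.filter fun x : Fin n × Fin n =>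
    x.1 < x.2 ∧ τ.symm x.1 < τ.symm x.2 ∧ τ'.symm x.2 < τ'.symm x.1).card = k
  induction k using Nat.strong_induction_on generalizing S τ with
  | _ k ih =>
    by_cases hmono : ∀ k (hk : k + 1 < n),
        τ'.symm (τ ⟨k, by omega⟩) < τ'.symm (τ ⟨k + 1, hk⟩)
    · have hst : StrictMono (τ'.symm ∘ τ) := strictMono_of_lt_succ hmono
      have : τ = τ' := Equiv.ext fun x => by
        have := hst.apply_eq (x := x)
        rwa [Function.comp_apply, Equiv.symm_apply_eq] at this
      exact ⟨S, le_rfl, this ▸ hτ⟩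
    · push Not at hmono
      obtain ⟨m, hm, hle⟩ := hmono
      set i := τ ⟨m, by omega⟩ with hi
      set j := τ ⟨m + 1, hm⟩ with hj
      have hpi : τ.symm i = ⟨m, by omega⟩ := by simp [hi]
      have hpj : τ.symm j = ⟨m + 1, hm⟩ := by simp [hj]
      have hne : i ≠ j := fun hij => by
        rw [hij, hpj, Fin.mk.injEq] at hpi
        omega
      have hlt' : τ'.symm j < τ'.symm i := lt_of_le_of_ne hle (τ'.symm.injective.ne hne.symm)
      have hpos : τ.symm i < τ.symm j := by rw [hpi, hpj]; simp
      have hlt : i < j := by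
        refine lt_of_le_of_ne (not_lt.1 fun hji => ?_) hne
        exact lt_asymm hlt' (hinv j i hji hpos)
      obtain ⟨S₁, hS₁, hext⟩ := S.exists_of_swap hτ hlt (by rw [hpi, hpj])
      have hsymm : ∀ x, (Equiv.swap i j * τ).symm x = τ.symm (Equiv.swap i j x) := fun x => rfl
      have hinj : ∀ x y, (τ.symm x : ℕ) = τ.symm y → x = y := fun x y hxy =>
        τ.symm.injective (Fin.ext hxy)
      have key : ∀ x y, ¬ (x = i ∧ y = j) → ¬ (x = j ∧ y = i) →
          (τ.symm (Equiv.swap i j x) < τ.symm (Equiv.swap i j y) ↔ τ.symm x < τ.symm y) := by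
        intro x y h1 h2
        have hpi' : (τ.symm i : ℕ) = m := by rw [hpi]
        have hpj' : (τ.symm j : ℕ) = m + 1 := by rw [hpj]
        have h1 := hinj x i
        have h2 := hinj x j
        have h3 := hinj y i
        have h4 := hinj y j
        rw [Fin.lt_def, Fin.lt_def]
        rw [Equiv.swap_apply_def, Equiv.swap_apply_def]
        split_ifs <;> grind
      suffices H : ∃ S' : CambrianTree ε, S₁ ≤ S' ∧ IsLinearExtension S'.1 τ' from
        let ⟨S₂, hS₂, hext₂⟩ := H
        ⟨S₂, hS₁.trans hS₂, hext₂⟩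
      refine ih _ ?_ S₁ hext ?_ rfl
      · rw [← hk]
        refine Finset.card_lt_card ⟨fun x hx => ?_, fun hsub => ?_⟩
        · simp only [Finset.mem_filter, Finset.mem_univ, true_and, hsymm] at hx ⊢
          obtain ⟨h1, h2, h3⟩ := hx
          refine ⟨h1, ?_, h3⟩
          rwa [key] at h2
          · rintro ⟨h4, h5⟩
            rw [h4, h5, Equiv.swap_apply_left, Equiv.swap_apply_right] at h2
            exact lt_asymm h2 hpos
          · rintro ⟨h4, h5⟩
            rw [h4, h5] at h1
            exact lt_asymm h1 hlt
        · have := @hsub (i, j) (by simp [hlt, hpos, hlt'])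
          simp only [Finset.mem_filter, Finset.mem_univ, true_and, hsymm, Equiv.swap_apply_left,
            Equiv.swap_apply_right] at this
          exact lt_asymm this.2.1 hpos
      · intro a b hab hba
        rw [hsymm, hsymm] at hba
        by_cases h1 : a = i ∧ b = j
        · rw [h1.1, h1.2]; exact hlt'
        · refine hinv a b hab ((key b a ?_ ?_).1 hba)
          · rintro ⟨h4, h5⟩
            rw [h4, h5] at hab
            exact lt_asymm hab hlt
          · exact fun h4 => h1 ⟨h4.2, h4.1⟩

end Cambrian

namespace Cambrian

variable {n n' : ℕ} {ε : Fin n → ℤˣ} {ε' : Fin n' → ℤˣ}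

/-! ### Trees and their linear extensions -/

/-- A linear extension determines the tree. -/
theorem CambrianTree.eq_of_arcs_lt {T T' : CambrianTree ε} {β : Type*} [Preorder β] {s : Fin n → β}
    (h : ∀ a b, T.1.Adj a b → s a < s b) (h' : ∀ a b, T'.1.Adj a b → s a < s b) : T = T' := by
  obtain ⟨N, hN⟩ := T.exists_routed
  obtain ⟨N', hN'⟩ := T'.exists_routed
  exact Subtype.ext (Digraph.ext (hN.eq_of_common_extension hN' h h'))

/-- Some Cambrian tree has the identity as a linear extension: graft one-vertex trees. -/
theorem exists_tree_one : ∀ {n : ℕ} (ε : Fin n → ℤˣ),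
    ∃ S : CambrianTree ε, ∀ a b, S.1.Adj a b → a < b := by
  intro n
  induction n with
  | zero =>
    intro ε
    refine ⟨⟨⟨fun _ _ => False⟩, Routed.isCambrian (N := fun v _ => v) ?_⟩, fun a => a.elim0⟩
    constructor <;> exact fun a => a.elim0
  | succ n ih =>
    intro ε
    have hε : ε = Fin.append (fun i => ε (Fin.castAdd 1 i)) (fun i => ε (Fin.natAdd n i)) := by
      funext v
      induction v using Fin.addCases <;> simp
    rw [hε]
    obtain ⟨T, hT⟩ := ih fun i => ε (Fin.castAdd 1 i)
    have hone : IsCambrian (fun i : Fin 1 => ε (Fin.natAdd n i)) ⟨fun _ _ => False⟩ := by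
      refine Routed.isCambrian (N := fun v _ => v) ?_
      constructor
      all_goals simp [Sgl, Dbl, Subsingleton.elim _ (0 : Fin 1)]
    refine ⟨⟨_, isCambrian_graftUp T ⟨_, hone⟩⟩, fun a b hab => ?_⟩
    induction a using Fin.addCases <;> induction b using Fin.addCases
    · exact hT _ _ (shiftedUnion_cast_cast.1 hab)
    · exact castAdd_lt_natAdd _ _
    · exact (shiftedUnion_nat_cast.1 hab).elim
    · exact (shiftedUnion_nat_nat.1 hab).elim

/-- Every permutation is a linear extension of a Cambrian tree. -/
theorem exists_tree (ε : Fin n → ℤˣ) (τ : Equiv.Perm (Fin n)) :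
    ∃ S : CambrianTree ε, IsLinearExtension S.1 τ := by
  obtain ⟨S, hS⟩ := exists_tree_one ε
  obtain ⟨S', _, h⟩ := S.exists_of_weak_le (τ := 1) (τ' := τ) hS
    fun a b hab hba => absurd hba (lt_asymm hab)
  exact ⟨S', h⟩

/-- Along the Cambrian order, relations `a ≺ b` with `a < b` get lost, and relations `a ≺ b` with
`b < a` persist. -/
theorem CambrianTree.transGen_of_le {S S' : CambrianTree ε} (hle : S ≤ S') :
    (∀ a b, a < b → Relation.TransGen S'.1.Adj a b → Relation.TransGen S.1.Adj a b) ∧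
      ∀ a b, b < a → Relation.TransGen S.1.Adj a b → Relation.TransGen S'.1.Adj a b := by
  change Relation.ReflTransGen IsIncreasingRotation S S' at hle
  induction hle with
  | refl => exact ⟨fun _ _ _ => id, fun _ _ _ => id⟩
  | @tail S₁ S₂ _ hrot ih =>
    obtain ⟨i, j, hlt, hij, heq⟩ := hrot
    obtain ⟨N, h⟩ := S₁.exists_routed
    have hadj : S₂.1.Adj = Rot S₁.1.Adj (IsNeg ε) i j := by
      rw [heq]
      funext x y
      exact propext rotate_adj_iff
    rw [hadj]
    exact ⟨fun a b hab h1 => ih.1 a b hab (h.transGen_of_transGen_rot hij hlt hab h1),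
      fun a b hab h1 => h.transGen_rot_of_transGen hij hlt hab (ih.2 a b hab h1)⟩

theorem exists_sort {m : ℕ} {α : Type*} [LinearOrder α] {f : Fin m → α}
    (hf : Function.Injective f) :
    ∃ τ : Equiv.Perm (Fin m), StrictMono (f ∘ τ) :=
  ⟨Tuple.sort f,
    (Tuple.monotone_sort f).strictMono_of_injective (hf.comp (Tuple.sort f).injective)⟩

/-- Let the labels of `T` be embedded as an interval into those of `S`, and suppose that the order
of `S` restricts to a subset of that of `T`. Then linear extensions of `S` restrict to linear
extensions of `T`: the arcs of the tree of the restricted permutation are strands, hence relations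
of `S` and so of `T`, and therefore this tree is `T`. -/
theorem CambrianTree.lt_of_restrict (S : CambrianTree ε') {σ : Equiv.Perm (Fin n')}
    (hσ : IsLinearExtension S.1 σ) (T : CambrianTree ε) {e : Fin n → Fin n'} (he : StrictMono e)
    (hconv : ∀ a b x, e a < x → x < e b → ∃ y, x = e y) (hε : ∀ v, ε' (e v) = ε v)
    (hT : ∀ a b, Relation.TransGen S.1.Adj (e a) (e b) → Relation.TransGen T.1.Adj a b)
    {a b : Fin n} (hab : T.1.Adj a b) : σ.symm (e a) < σ.symm (e b) := by
  set f : Fin n → Fin n' := fun a => σ.symm (e a) with hf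
  have hfi : Function.Injective f := σ.symm.injective.comp he.injective
  obtain ⟨τ, hsort⟩ := exists_sort hfi
  obtain ⟨U, hU⟩ := exists_tree ε τ
  have hUf : ∀ a b, U.1.Adj a b → f a < f b := fun a b hab => by
    simpa using hsort (hU a b hab)
  obtain ⟨NS, hNS⟩ := S.exists_routed
  obtain ⟨NT, hNT⟩ := T.exists_routed
  obtain ⟨NU, hNU⟩ := U.exists_routed
  obtain ⟨s, hs⟩ := hNT.exists_height
  have hUs : ∀ a b, U.1.Adj a b → s a < s b := by
    intro a b hab
    obtain ⟨h1, h2⟩ := hNU.strand_of_arc hUf hab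
    have hst : Strand (IsNeg ε') (σ.symm : Fin n' → Fin n') (e a) (e b) := by
      refine ⟨h1, fun x hx => ?_⟩
      obtain ⟨y, rfl⟩ : ∃ y, x = e y := by
        rcases hx with ⟨h3, h4⟩ | ⟨h3, h4⟩ <;> exact hconv _ _ _ h3 h4
      have := h2 y (by unfold Between at *; rwa [he.lt_iff_lt, he.lt_iff_lt, he.lt_iff_lt,
        he.lt_iff_lt] at hx)
      unfold IsNeg at *
      rwa [hε]
    exact lt_of_transGen hs (hT a b (hNS.transGen_of_strand hσ hst))
  have hUT : U = T := CambrianTree.eq_of_arcs_lt hUs hs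
  exact hUf a b (hUT ▸ hab)

/-- Paths between points of the image of `e` stay there if every arc that ends in the image starts
there. -/
theorem transGen_of_closed {α β : Type*} {r : α → α → Prop} {R : β → β → Prop} {e : α → β}
    (he : Function.Injective e) (h : ∀ x c, R x (e c) → ∃ b, x = e b ∧ r b c) {a c : α}
    (hac : Relation.TransGen R (e a) (e c)) : Relation.TransGen r a c := by
  have key : ∀ y, Relation.TransGen R (e a) y → ∀ c, y = e c → Relation.TransGen r a c := by
    intro y hy
    induction hy with
    | single h1 =>
      rintro c rfl
      obtain ⟨b, hb, hbc⟩ := h _ _ h1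
      exact .single (he hb ▸ hbc)
    | tail _ h1 ih =>
      rintro c rfl
      obtain ⟨b, rfl, hbc⟩ := h _ _ h1
      exact .tail (ih b rfl) hbc
  exact key _ hac c rfl

/-- Paths between points of the image of `e` stay there if every arc that starts in the image ends
there. -/
theorem transGen_of_closed' {α β : Type*} {r : α → α → Prop} {R : β → β → Prop} {e : α → β}
    (he : Function.Injective e) (h : ∀ x c, R (e c) x → ∃ b, x = e b ∧ r c b) {a c : α}
    (hac : Relation.TransGen R (e a) (e c)) : Relation.TransGen r a c :=
  Relation.transGen_swap.1 (transGen_of_closed (R := Function.swap R) (r := Function.swap r) he h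
    (Relation.transGen_swap.2 hac))

/-! ### The trees below the shuffles -/

/-- `graftUp` as an element of the Cambrian lattice. -/
def graftUpTree (T : CambrianTree ε) (T' : CambrianTree ε') : CambrianTree (Fin.append ε ε') :=
  ⟨graftUp T T', isCambrian_graftUp T T'⟩

/-- `graftDown` as an element of the Cambrian lattice. -/
def graftDownTree (T : CambrianTree ε) (T' : CambrianTree ε') : CambrianTree (Fin.append ε ε') :=
  ⟨graftDown T T', isCambrian_graftDown T T'⟩

/-- The values up to `n` of the word of `σ` form a linear extension of `D`, and the larger ones
form a linear extension of `D'`. -/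
def IsShuffleExtension (D : Digraph (Fin n)) (D' : Digraph (Fin n'))
    (σ : Equiv.Perm (Fin (n + n'))) : Prop :=
  (∀ a b, D.Adj a b → σ.symm (Fin.castAdd n' a) < σ.symm (Fin.castAdd n' b)) ∧
    ∀ a b, D'.Adj a b → σ.symm (Fin.natAdd n a) < σ.symm (Fin.natAdd n b)

/-- The linear extensions of the trees in the interval restrict to linear extensions of `T` and
`T'`. -/
theorem isShuffleExtension_of_mem_Icc {T : CambrianTree ε} {T' : CambrianTree ε'}
    {S : CambrianTree (Fin.append ε ε')}
    (h₁ : graftUpTree T T' ≤ S)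
    (h₂ : S ≤ graftDownTree T T')
    {σ : Equiv.Perm (Fin (n + n'))} (hσ : IsLinearExtension S.1 σ) :
    IsShuffleExtension T.1 T'.1 σ := by
  obtain ⟨NS, hNS⟩ := S.exists_routed
  have hinj := Fin.castAdd_injective n n'
  have hinj' := Fin.natAdd_injective n' n
  constructor
  · refine fun a b hab => S.lt_of_restrict hσ T (e := Fin.castAdd n') (fun a b h => h) ?_ ?_ ?_ hab
    · intro a b x _ hx
      induction x using Fin.addCases with
      | left y => exact ⟨y, rfl⟩
      | right y => exact (not_natAdd_lt_castAdd _ _ hx).elim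
    · simp
    · intro a b hab
      rcases lt_trichotomy a b with hlt | rfl | hlt
      · refine transGen_of_closed hinj (fun x c hxc => ?_)
          ((CambrianTree.transGen_of_le h₁).1 (Fin.castAdd n' a) (Fin.castAdd n' b) hlt hab)
        induction x using Fin.addCases with
        | left y => exact ⟨y, rfl, shiftedUnion_cast_cast.1 hxc⟩
        | right y => exact (shiftedUnion_nat_cast.1 hxc).elim
      · exact ((hNS.adj_route_of_transGen hab).1 rfl).elim
      · refine transGen_of_closed' hinj (fun x c hxc => ?_)
          ((CambrianTree.transGen_of_le h₂).2 (Fin.castAdd n' a) (Fin.castAdd n' b) hlt hab)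
        induction x using Fin.addCases with
        | left y => exact ⟨y, rfl, shiftedUnion_cast_cast.1 hxc⟩
        | right y => exact (shiftedUnion_cast_nat.1 hxc).elim
  · refine fun a b hab => S.lt_of_restrict hσ T' (e := Fin.natAdd n)
      (fun a b h => (Fin.natAdd_lt_natAdd_iff n).2 h) ?_ ?_ ?_ hab
    · intro a b x hx _
      induction x using Fin.addCases with
      | left y => exact (not_natAdd_lt_castAdd _ _ hx).elim
      | right y => exact ⟨y, rfl⟩
    · simp
    · intro a b hab
      rcases lt_trichotomy a b with hlt | rfl | hlt
      · refine transGen_of_closed' hinj' (fun x c hxc => ?_)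
          ((CambrianTree.transGen_of_le h₁).1 (Fin.natAdd n a) (Fin.natAdd n b)
            ((Fin.natAdd_lt_natAdd_iff n).2 hlt) hab)
        induction x using Fin.addCases with
        | left y => exact (shiftedUnion_nat_cast.1 hxc).elim
        | right y => exact ⟨y, rfl, shiftedUnion_nat_nat.1 hxc⟩
      · exact ((hNS.adj_route_of_transGen hab).1 rfl).elim
      · refine transGen_of_closed hinj' (fun x c hxc => ?_)
          ((CambrianTree.transGen_of_le h₂).2 (Fin.natAdd n a) (Fin.natAdd n b)
            ((Fin.natAdd_lt_natAdd_iff n).2 hlt) hab)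
        induction x using Fin.addCases with
        | left y => exact (shiftedUnion_cast_nat.1 hxc).elim
        | right y => exact ⟨y, rfl, shiftedUnion_nat_nat.1 hxc⟩

/-- `exists_sort` in terms of the position `τ.symm a` of the value `a`. -/
theorem exists_perm_lt_iff {m : ℕ} {f : Fin m → ℕ} (hf : Function.Injective f) :
    ∃ τ : Equiv.Perm (Fin m), ∀ a b, τ.symm a < τ.symm b ↔ f a < f b := by
  obtain ⟨τ, hsort⟩ := exists_sort hf
  refine ⟨τ, fun a b => ?_⟩
  rw [← hsort.lt_iff_lt]
  simp

/-- A permutation whose restrictions are linear extensions of `T` and `T'` lies, in the weak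
order, between the two concatenations of its restrictions. These are linear extensions of the two
grafted trees, so the tree of the permutation lies in the interval. -/
theorem exists_mem_Icc {T : CambrianTree ε} {T' : CambrianTree ε'}
    {σ : Equiv.Perm (Fin (n + n'))} (hσ : IsShuffleExtension T.1 T'.1 σ) :
    ∃ S : CambrianTree (Fin.append ε ε'),
      graftUpTree T T' ≤ S ∧
      S ≤ graftDownTree T T' ∧ IsLinearExtension S.1 σ := by
  -- the positions in the two concatenations, up to a monotone reparametrization
  let f : Fin (n + n') → ℕ := Fin.addCases (fun a => (σ.symm (Fin.castAdd n' a) : ℕ))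
    (fun b => (σ.symm (Fin.natAdd n b) : ℕ) + (n + n'))
  let g : Fin (n + n') → ℕ := Fin.addCases (fun a => (σ.symm (Fin.castAdd n' a) : ℕ) + (n + n'))
    (fun b => (σ.symm (Fin.natAdd n b) : ℕ))
  have hinj : ∀ x y, (σ.symm x : ℕ) = σ.symm y → x = y := fun x y hxy =>
    σ.symm.injective (Fin.ext hxy)
  have hb : ∀ x, (σ.symm x : ℕ) < n + n' := fun x => (σ.symm x).2
  have hf : Function.Injective f := by
    intro x y hxy
    have h1 := hb x
    have h2 := hb y
    induction x using Fin.addCases <;> induction y using Fin.addCases <;>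
      simp only [f, Fin.addCases_left, Fin.addCases_right] at hxy
    all_goals exact hinj _ _ (by omega)
  have hg : Function.Injective g := by
    intro x y hxy
    have h1 := hb x
    have h2 := hb y
    induction x using Fin.addCases <;> induction y using Fin.addCases <;>
      simp only [g, Fin.addCases_left, Fin.addCases_right] at hxy
    all_goals exact hinj _ _ (by omega)
  obtain ⟨τ, hτ⟩ := exists_perm_lt_iff hf
  obtain ⟨τ', hτ'⟩ := exists_perm_lt_iff hg
  obtain ⟨S, hS, hSσ⟩ := (graftUpTree T T').exists_of_weak_le
    (τ := τ) (τ' := σ) (by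
      intro a b hab
      rw [hτ]
      have h1 := hb a
      have h2 := hb b
      induction a using Fin.addCases <;> induction b using Fin.addCases <;>
        simp only [f, Fin.addCases_left, Fin.addCases_right]
      · exact hσ.1 _ _ (shiftedUnion_cast_cast.1 hab)
      · omega
      · exact (shiftedUnion_nat_cast.1 hab).elim
      · exact Nat.add_lt_add_right (hσ.2 _ _ (shiftedUnion_nat_nat.1 hab)) _) (by
      intro a b hab hba
      rw [hτ] at hba
      have h1 := hb a
      have h2 := hb b
      rw [Fin.lt_def]
      induction a using Fin.addCases <;> induction b using Fin.addCases <;>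
        simp only [f, Fin.addCases_left, Fin.addCases_right] at hba
      all_goals first | omega | exact (not_natAdd_lt_castAdd _ _ hab).elim)
  obtain ⟨S', hS', hSτ'⟩ := S.exists_of_weak_le (τ' := τ') hSσ (by
      intro a b hab hba
      rw [hτ']
      rw [Fin.lt_def] at hba
      have h1 := hb a
      have h2 := hb b
      induction a using Fin.addCases <;> induction b using Fin.addCases <;>
        simp only [g, Fin.addCases_left, Fin.addCases_right]
      all_goals first | omega | exact (not_natAdd_lt_castAdd _ _ hab).elim)
  refine ⟨S, hS, ?_, hSσ⟩
  have : S' = graftDownTree T T' := by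
    refine CambrianTree.eq_of_arcs_lt hSτ' fun a b hab => ?_
    rw [hτ']
    have h1 := hb a
    have h2 := hb b
    induction a using Fin.addCases <;> induction b using Fin.addCases <;>
      simp only [g, Fin.addCases_left, Fin.addCases_right]
    · exact Nat.add_lt_add_right (hσ.1 _ _ (shiftedUnion_cast_cast.1 hab)) _
    · exact (shiftedUnion_cast_nat.1 hab).elim
    · omega
    · exact hσ.2 _ _ (shiftedUnion_nat_nat.1 hab)
  exact this ▸ hS'

end Cambrian

namespace Cambrian

variable {n n' : ℕ} {ε : Fin n → ℤˣ} {ε' : Fin n' → ℤˣ}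

/-! ### The product -/

theorem finsupp_sum_sum_single {R α M ι κ : Type*} [CommRing R] [AddCommGroup M] [Module R M]
    (m : α → α → M) (s : Finset ι) (t : Finset κ) (f : ι → α) (g : κ → α) :
    ((∑ i ∈ s, Finsupp.single (f i) (1 : R)).sum fun x a =>
      (∑ j ∈ t, Finsupp.single (g j) (1 : R)).sum fun y b => (a * b) • m x y) =
      ∑ i ∈ s, ∑ j ∈ t, m (f i) (g j) := by
  classical
  rw [← Finsupp.sum_finsetSum_index]
  · refine Finset.sum_congr rfl fun i _ => ?_
    rw [Finsupp.sum_single_index (by simp), ← Finsupp.sum_finsetSum_index]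
    · refine Finset.sum_congr rfl fun j _ => ?_
      rw [Finsupp.sum_single_index] <;> simp
    · simp
    · simp [mul_add, add_smul]
  · simp
  · intro x a₁ a₂
    rw [← Finsupp.sum_add]
    simp [add_mul, add_smul]

theorem sum_F_mul_sum_F (R : Type*) [CommRing R] {ι κ : Type*} (s : Finset ι) (t : Finset κ)
    (f : ι → SignedPerm) (g : κ → SignedPerm) :
    (∑ i ∈ s, F R (f i)) * (∑ j ∈ t, F R (g j)) =
      ∑ i ∈ s, ∑ j ∈ t, ∑ σ ∈ shiftedShuffle (f i) (g j), F R σ :=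
  finsupp_sum_sum_single (M := FQSym R) (fun τ τ' => ∑ σ ∈ shiftedShuffle τ τ', F R σ) s t f g

theorem shiftedConcat_cast (τ : Equiv.Perm (Fin n)) (τ' : Equiv.Perm (Fin n')) (a : Fin n) :
    shiftedConcat τ τ' (Fin.castAdd n' a) = Fin.castAdd n' (τ a) := by
  simp [shiftedConcat]

theorem shiftedConcat_nat (τ : Equiv.Perm (Fin n)) (τ' : Equiv.Perm (Fin n')) (b : Fin n') :
    shiftedConcat τ τ' (Fin.natAdd n b) = Fin.natAdd n (τ' b) := by
  simp [shiftedConcat]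

theorem shuffle_symm_cast (τ : Equiv.Perm (Fin n)) (τ' : Equiv.Perm (Fin n'))
    (π : Equiv.Perm (Fin (n + n'))) (a : Fin n) :
    (shiftedConcat τ τ' * π⁻¹).symm (Fin.castAdd n' a) = π (Fin.castAdd n' (τ.symm a)) := by
  rw [Equiv.symm_apply_eq]
  simp [shiftedConcat_cast]

theorem shuffle_symm_nat (τ : Equiv.Perm (Fin n)) (τ' : Equiv.Perm (Fin n'))
    (π : Equiv.Perm (Fin (n + n'))) (b : Fin n') :
    (shiftedConcat τ τ' * π⁻¹).symm (Fin.natAdd n b) = π (Fin.natAdd n (τ'.symm b)) := by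
  rw [Equiv.symm_apply_eq]
  simp [shiftedConcat_nat]

theorem perm_eq_of_strictMono {m k : ℕ} {f : Fin m → Fin k} {τ τ' : Equiv.Perm (Fin m)}
    (hf : Function.Injective f) (h : StrictMono (f ∘ τ)) (h' : StrictMono (f ∘ τ')) : τ = τ' := by
  have h1 : f ∘ τ = f ∘ τ' := (h.range_inj h').1 (by simp [Set.range_comp])
  exact Equiv.ext fun x => hf (congrFun h1 x)

/-- A permutation is a shuffle of exactly two permutations in exactly one way. -/
theorem shuffle_injective {τ₁ τ₂ : Equiv.Perm (Fin n)} {τ₁' τ₂' : Equiv.Perm (Fin n')}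
    {π₁ π₂ : Equiv.Perm (Fin (n + n'))} (h₁ : IsShuffler n n' π₁) (h₂ : IsShuffler n n' π₂)
    (h : shiftedConcat τ₁ τ₁' * π₁⁻¹ = shiftedConcat τ₂ τ₂' * π₂⁻¹) :
    τ₁ = τ₂ ∧ τ₁' = τ₂' ∧ π₁ = π₂ := by
  have e1 : τ₁ = τ₂ := by
    refine perm_eq_of_strictMono
      (f := fun a => (shiftedConcat τ₁ τ₁' * π₁⁻¹).symm (Fin.castAdd n' a))
      ((Equiv.injective _).comp (Fin.castAdd_injective n n')) ?_ ?_
    · intro a b hab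
      simpa only [Function.comp_apply, shuffle_symm_cast, Equiv.symm_apply_apply] using h₁.1 hab
    · rw [h]
      intro a b hab
      simpa only [Function.comp_apply, shuffle_symm_cast, Equiv.symm_apply_apply] using h₂.1 hab
  have e2 : τ₁' = τ₂' := by
    refine perm_eq_of_strictMono (f := fun a => (shiftedConcat τ₁ τ₁' * π₁⁻¹).symm (Fin.natAdd n a))
      ((Equiv.injective _).comp (Fin.natAdd_injective n' n)) ?_ ?_
    · intro a b hab
      simpa only [Function.comp_apply, shuffle_symm_nat, Equiv.symm_apply_apply] using h₁.2 hab
    · rw [h]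
      intro a b hab
      simpa only [Function.comp_apply, shuffle_symm_nat, Equiv.symm_apply_apply] using h₂.2 hab
  subst e1 e2
  exact ⟨rfl, rfl, inv_injective (mul_left_cancel h)⟩

theorem exists_shuffle (σ : Equiv.Perm (Fin (n + n'))) :
    ∃ (τ : Equiv.Perm (Fin n)) (τ' : Equiv.Perm (Fin n')) (π : Equiv.Perm (Fin (n + n'))),
      IsShuffler n n' π ∧ shiftedConcat τ τ' * π⁻¹ = σ := by
  obtain ⟨τ, hτ⟩ := exists_sort (f := fun a => σ.symm (Fin.castAdd n' a))
    ((Equiv.injective _).comp (Fin.castAdd_injective n n'))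
  obtain ⟨τ', hτ'⟩ := exists_sort (f := fun a => σ.symm (Fin.natAdd n a))
    ((Equiv.injective _).comp (Fin.natAdd_injective n' n))
  refine ⟨τ, τ', σ⁻¹ * shiftedConcat τ τ', ⟨fun a b hab => ?_, fun a b hab => ?_⟩, by group⟩
  · simpa [shiftedConcat_cast] using hτ hab
  · simpa [shiftedConcat_nat] using hτ' hab

theorem isShuffleExtension_iff {D : Digraph (Fin n)} {D' : Digraph (Fin n')}
    {τ : Equiv.Perm (Fin n)} {τ' : Equiv.Perm (Fin n')} {π : Equiv.Perm (Fin (n + n'))}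
    (hπ : IsShuffler n n' π) : IsShuffleExtension D D' (shiftedConcat τ τ' * π⁻¹) ↔
      IsLinearExtension D τ ∧ IsLinearExtension D' τ' := by
  simp only [IsShuffleExtension, IsLinearExtension, shuffle_symm_cast, shuffle_symm_nat]
  have h1 := fun a b : Fin n => hπ.1.lt_iff_lt (a := a) (b := b)
  have h2 := fun a b : Fin n' => hπ.2.lt_iff_lt (a := a) (b := b)
  simp only [h1, h2]

open Classical in
/-- The product of `P_T` and `P_T'` collects the permutations whose restrictions to the small and
to the large values are linear extensions of `T` and `T'`. -/
theorem P_mul_P (R : Type*) [CommRing R] (T : CambrianTree ε) (T' : CambrianTree ε') :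
    P R T * P R T' = ∑ σ : Equiv.Perm (Fin (n + n')) with IsShuffleExtension T.1 T'.1 σ,
      F R ⟨n + n', σ, Fin.append ε ε'⟩ := by
  have hshuffle : ∀ (τ : Equiv.Perm (Fin n)) (τ' : Equiv.Perm (Fin n')),
      ∑ σ ∈ shiftedShuffle ⟨n, τ, ε⟩ ⟨n', τ', ε'⟩, F R σ =
        ∑ π : Equiv.Perm (Fin (n + n')) with IsShuffler n n' π,
          F R ⟨n + n', shiftedConcat τ τ' * π⁻¹, Fin.append ε ε'⟩ := by
    intro τ τ'
    rw [shiftedShuffle, Finset.sum_image]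
    · refine Finset.sum_congr ?_ fun _ _ => rfl
      ext π
      simp
    · intro π₁ h₁ π₂ h₂ heq
      simp only [Set.coe_toFinset, Set.mem_ofPred_eq] at h₁ h₂
      simp only [SignedPerm.mk.injEq, heq_eq_eq, true_and, and_true] at heq
      exact (shuffle_injective h₁ h₂ heq).2.2
  rw [P, P, sum_F_mul_sum_F]
  simp only [hshuffle]
  -- the triples `((τ, τ'), π)` are in bijection with the permutations on the right
  rw [← Finset.sum_product', ← Finset.sum_product']
  refine Finset.sum_bij (fun x _ => shiftedConcat x.1.1 x.1.2 * x.2⁻¹) ?_ ?_ ?_ ?_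
  · rintro ⟨⟨τ, τ'⟩, π⟩ hx
    simp only [Finset.mem_product, Finset.mem_filter, Finset.mem_univ, true_and] at hx ⊢
    exact (isShuffleExtension_iff hx.2).2 hx.1
  · rintro ⟨⟨τ, τ'⟩, π⟩ hx ⟨⟨τ₂, τ₂'⟩, π₂⟩ hx₂ heq
    simp only [Finset.mem_product, Finset.mem_filter, Finset.mem_univ, true_and] at hx hx₂
    obtain ⟨rfl, rfl, rfl⟩ := shuffle_injective hx.2 hx₂.2 heq
    rfl
  · intro σ hσ
    obtain ⟨τ, τ', π, hπ, rfl⟩ := exists_shuffle σ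
    simp only [Finset.mem_filter, Finset.mem_univ, true_and, isShuffleExtension_iff hπ] at hσ
    exact ⟨((τ, τ'), π), by simp [hσ, hπ], rfl⟩
  · exact fun _ _ => rfl

end Cambrian

open Classical in
theorem mainTheorem2 (R : Type*) [CommRing R] {n n' : ℕ} (ε : Fin n → ℤˣ) (ε' : Fin n' → ℤˣ)
    (T : Cambrian.CambrianTree ε) (T' : Cambrian.CambrianTree ε') :
    ∃ (h₁ : Cambrian.IsCambrian (Fin.append ε ε') (Cambrian.graftUp T T'))
      (h₂ : Cambrian.IsCambrian (Fin.append ε ε') (Cambrian.graftDown T T')),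
      Cambrian.P R T * Cambrian.P R T' =
        ∑ S : Cambrian.CambrianTree (Fin.append ε ε') with
          S ∈ Set.Icc ⟨Cambrian.graftUp T T', h₁⟩ ⟨Cambrian.graftDown T T', h₂⟩,
          Cambrian.P R S := by
  refine ⟨Cambrian.isCambrian_graftUp T T', Cambrian.isCambrian_graftDown T T', ?_⟩
  rw [Cambrian.P_mul_P]
  simp only [Cambrian.P]
  rw [← Finset.sum_biUnion]
  · refine Finset.sum_congr ?_ fun _ _ => rfl
    ext σ
    simp only [Finset.mem_filter, Finset.mem_univ, true_and, Finset.mem_biUnion]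
    constructor
    · intro hσ
      obtain ⟨S, h₁, h₂, h⟩ := Cambrian.exists_mem_Icc hσ
      exact ⟨S, ⟨h₁, h₂⟩, h⟩
    · rintro ⟨S, ⟨h₁, h₂⟩, h⟩
      exact Cambrian.isShuffleExtension_of_mem_Icc h₁ h₂ h
  · -- a permutation is a linear extension of only one tree
    intro S _ S' _ hne
    refine Finset.disjoint_left.2 fun σ h h' => hne ?_
    simp only [Finset.mem_filter, Finset.mem_univ, true_and] at h h'
    exact Cambrian.CambrianTree.eq_of_arcs_lt h h'
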